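/- Let $d\ge 2$ be an integer, $\gamma>0$ and $c=\gamma-d-1$. For a vector field $\vartheta:\mathbb R^d\to\mathbb C^d$ and $0<\beta<1$ put $$\mathcal R_\beta[\vartheta](\eta)=\beta^{c}e^{|\eta|^\gamma(1-\beta^{-\gamma})}\,\vartheta\!\left(\frac{\eta}{\beta}\right)+i\gamma\int_1^{1/\beta}\frac{e^{|\eta|^\gamma(1-t^\gamma)}}{t^{c}}\int_{\mathbb R^d}\bigl(\eta\cdot\vartheta(t\eta-x)\bigr)\,P_\eta\vartheta(x)\,dx\,dt,$$ where $P_\eta v=v-\frac{v\cdot\eta}{|\eta|^2}\eta$. For $\nu\in\mathbb R$ and $p>1$ let $u_\nu(x)=e^{|x|}|x|^\nu$ and $\|f\|_{u_\nu,p}=\left(\int_{\mathbb R^d}|f(x)|^p u_\nu(x)^p\,dx\right)^{1/p}$; let $\mathfrak L^p_{u_\nu}$ be the space of measurable fields $f:\mathbb R^d\to\mathbb C^d\cong\mathbb R^{2d}$ (modulo null sets) of finite norm, and $\mathfrak R^p_{u_\nu}$ its subspace of radial fields, i.e. of fields all of whose components depend only on $|x|$. Suppose that $p>1$, $r>1$,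 $\nu$ and $\kappa$ are real numbers with $$\frac1r=\frac2p+\frac{2\nu+\kappa}{d}-1,\quad \kappa<\frac dr,\quad \frac{d-1}{2}\Bigl(1-\frac2p\Bigr)<\nu<d\,\frac{p-1}{p},\quad 2r\ge p,\quad \max\{\nu,\kappa\}>0,\quad \nu+\kappa\ge(d-1)\Bigl(\frac1r-\frac1p\Bigr),$$ $$\max\{0,\,d+p(c+\nu)\}<\frac{d(r-p)}{r}+p(\nu+\kappa+1)<\frac{\gamma p(r-1)}{r},$$ $$\frac{\gamma p(r-1)}{r}-\frac{d(r-p)}{r}-p(\nu+\kappa+1)>\gamma,\qquad p>\frac{r}{r-1}.$$ Then for every $\beta\in(0,1)$ there is $\widehat A>0$ such that $\mathcal R_\beta$ is a contraction on the convex set $$\widehat{\mathcal E}=\{\vartheta\in\mathfrak R^p_{u_\nu}:\ \|\vartheta\|_{u_\nu,p}\le\widehat A\}.$$ That is, for every $\vartheta\in\widehat{\mathcal E}$ the double integral defining $\mathcal R_\beta[\vartheta](\eta)$ converges absolutely for almost every $\eta$, the field $\mathcal R_\beta[\vartheta]$ (which need not be radial) belongs to $\mathfrak L^p_{u_\nu}$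 and satisfies $|\mathcal R_\beta[\vartheta]|\le|g|$ almost everywhere for some $g\in\widehat{\mathcal E}$, and there is $q<1$ such that $$\|\mathcal R_\beta[\vartheta_1]-\mathcal R_\beta[\vartheta_2]\|_{u_\nu,p}\le q\,\|\vartheta_1-\vartheta_2\|_{u_\nu,p}\qquad\text{for all }\vartheta_1,\vartheta_2\in\widehat{\mathcal E}.$$ In particular, $0$ is the only fixed point of $\mathcal R_\beta$ in $\widehat{\mathcal E}$. -/

import Mathlib

open MeasureTheory

noncomputable section

namespace NSRenorm

/-- The frequency space `ℝ^d` with its Euclidean norm. -/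
abbrev RSpace (d : ℕ) : Type := EuclideanSpace ℝ (Fin d)

/-- The space of values `ℂ^d = ℝ^(2d)` with its Euclidean norm. -/
abbrev CSpace (d : ℕ) : Type := EuclideanSpace ℂ (Fin d)

/-- The (complex bilinear) scalar product `y · v` of a real and a complex vector. -/
def dotRC {d : ℕ} (y : RSpace d) (v : CSpace d) : ℂ := ∑ i, (y i : ℂ) * v i

/-- The Leray projection `P_y v = v - ((v · y) / |y|²) y`. -/
def leray {d : ℕ} (y : RSpace d) (v : CSpace d) : CSpace d :=
  WithLp.toLp 2 fun i => v i - dotRC y v / ((‖y‖ ^ 2 : ℝ) : ℂ) * (y i : ℂ)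

/-- The scaling exponent `c = γ - d - 1`. -/
def scalingExp (d : ℕ) (γ : ℝ) : ℝ := γ - d - 1

/-- The integrand of the nonlinear term:
`e^{|η|^γ (1 - t^γ)} t^{-c} (η · ϑ(tη - x)) P_η ϑ(x)`. -/
def nonlinIntegrand {d : ℕ} (γ : ℝ) (ϑ : RSpace d → CSpace d) (η : RSpace d)
    (t : ℝ) (x : RSpace d) : CSpace d :=
  (Real.exp (‖η‖ ^ γ * (1 - t ^ γ)) / t ^ scalingExp d γ) •
    (dotRC η (ϑ (t • η - x)) • leray η (ϑ x))

/-- The renormalization operator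
`R_β[ϑ](η) = β^c e^{|η|^γ (1 - β^{-γ})} ϑ(η/β)
  + i γ ∫_1^{1/β} e^{|η|^γ (1 - t^γ)} t^{-c} ∫_{ℝ^d} (η · ϑ(tη - x)) P_η ϑ(x) dx dt`. -/
def renorm {d : ℕ} (γ β : ℝ) (ϑ : RSpace d → CSpace d) (η : RSpace d) : CSpace d :=
  (β ^ scalingExp d γ * Real.exp (‖η‖ ^ γ * (1 - 1 / β ^ γ))) • ϑ (β⁻¹ • η) +
    (Complex.I * (γ : ℂ)) • ∫ t in (1 : ℝ)..(1 / β), ∫ x, nonlinIntegrand γ ϑ η t x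

/-- Absolute convergence of the double integral in `R_β[ϑ](η)`. -/
def NonlinConverges {d : ℕ} (γ β : ℝ) (ϑ : RSpace d → CSpace d) (η : RSpace d) : Prop :=
  Integrable (fun z : ℝ × RSpace d => nonlinIntegrand γ ϑ η z.1 z.2)
    ((volume.restrict (Set.Ioc (1 : ℝ) (1 / β))).prod volume)

/-- The weight `u_ν(x) = e^{|x|} |x|^ν`. -/
def weight {d : ℕ} (ν : ℝ) (x : RSpace d) : ℝ := Real.exp ‖x‖ * ‖x‖ ^ ν

/-- The weighted norm `‖f‖_{u_ν,p} = (∫ |f|^p u_ν^p dx)^{1/p}`, with values in `[0, ∞]`. -/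
def wnorm {d : ℕ} (ν p : ℝ) (f : RSpace d → CSpace d) : ENNReal :=
  eLpNorm (fun x => weight ν x • f x) (ENNReal.ofReal p) volume

/-- Membership in the weighted space `𝔏^p_{u_ν} = (L^p_{u_ν}(ℝ^d, ℝ))^{2d}`. -/
def MemL {d : ℕ} (ν p : ℝ) (f : RSpace d → CSpace d) : Prop :=
  AEStronglyMeasurable f volume ∧ wnorm ν p f < ⊤

/-- `f` depends (up to a null set) only on the radial coordinate, i.e. every component of `f`
is a radial function. -/
def IsRadial {d : ℕ} (f : RSpace d → CSpace d) : Prop :=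
  ∃ g : ℝ → CSpace d, Measurable g ∧ ∀ᵐ x : RSpace d, f x = g ‖x‖

/-- The ball `{ϑ ∈ 𝔑^p_{u_ν} : ‖ϑ‖_{u_ν,p} ≤ A}` of the space of radial fields. -/
def radialBall (d : ℕ) (ν p A : ℝ) : Set (RSpace d → CSpace d) :=
  {ϑ | MemL ν p ϑ ∧ IsRadial ϑ ∧ wnorm ν p ϑ ≤ ENNReal.ofReal A}

/-- The set of fields in `𝔏^p_{u_ν}` that are bounded in absolute value by a radial field of
weighted norm at most `A`. -/
def radiallyBoundedBall (d : ℕ) (ν p A : ℝ) : Set (RSpace d → CSpace d) :=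
  {ϑ | MemL ν p ϑ ∧ ∃ g ∈ radialBall d ν p A, ∀ᵐ x : RSpace d, ‖ϑ x‖ ≤ ‖g x‖}

end NSRenorm

end

/-!
Polarizing the quadratic term bounds `|R_β[u] - R_β[v]|` by the linear term in `|u - v|` plus
integrals over `1 < t < 1/β` of `e^{|η|^γ (1 - t^γ)} t^{-c} |η| (f * g)(tη)`, where `(f, g)` is
`(|u - v|, |u|)` or `(|v|, |u - v|)`. Since `e^{|x + z|} ≤ e^{|x|} e^{|z|}`, the exponential weight
passes through the convolution, and Young's and Hölder's inequalities give a convolution inequality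
for the power weight `|x|^ν` that costs a decay of order `|η|^{-τ}` for some `τ > 1 + δ`, where
`δ = d (1 - 1/p) - ν`. The factor `e^{|η|^γ (1 - t^γ)}` supplies this decay at the price of
`(t - 1)^{-τ/γ}`, which is integrable at `t = 1` as soon as `τ < γ`. So the nonlinear part is
bounded by a constant times the product of the norms, which is negligible on a ball of small
radius, while the linear part has norm at most `β^{c + ν + d/p} = β^{γ - 1 - δ} < 1`.

If `|ϑ|` is bounded by a radial function, the same bound evaluated at that function is invariant
under rotations, hence a radial function dominating `R_β[ϑ]`.
-/

namespace NSRenorm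

open MeasureTheory Module
open scoped ENNReal

/-! ### Minkowski's integral inequality and Young's convolution inequality -/

section Minkowski

variable {α β : Type*} [MeasurableSpace α] [MeasurableSpace β] {μ : Measure α} {ν : Measure β}
  {p : ℝ}

lemma rpow_lintegral_mul_le {G f : α → ℝ≥0∞} (hp : 1 ≤ p) (hG : AEMeasurable G μ)
    (hf : AEMeasurable f μ) :
    (∫⁻ x, G x * f x ∂μ) ^ p ≤ (∫⁻ x, G x ∂μ) ^ (p - 1) * ∫⁻ x, G x * f x ^ p ∂μ := by
  have hp0 : 0 < p := by linarith
  have hle : 1 / p ≤ 1 := (div_le_one hp0).2 hp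
  have hsplit (x : α) : G x ^ (1 - 1 / p) * (G x * f x ^ p) ^ (1 / p) = G x * f x := by
    rw [ENNReal.mul_rpow_of_nonneg _ _ (by positivity), ← ENNReal.rpow_mul, ← mul_assoc,
      ← ENNReal.rpow_add_of_nonneg _ _ (by linarith) (by positivity), sub_add_cancel,
      ENNReal.rpow_one, mul_one_div_cancel hp0.ne', ENNReal.rpow_one]
  have holder := ENNReal.lintegral_mul_norm_pow_le (μ := μ) (g := fun x => G x * f x ^ p)
    hG (by fun_prop) (p := 1 - 1 / p) (q := 1 / p) (by linarith) (by positivity) (by ring)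
  simp only [hsplit] at holder
  refine (ENNReal.rpow_le_rpow holder hp0.le).trans_eq ?_
  rw [ENNReal.mul_rpow_of_nonneg _ _ hp0.le, ← ENNReal.rpow_mul, ← ENNReal.rpow_mul,
    one_div_mul_cancel hp0.ne', ENNReal.rpow_one, sub_mul, one_mul, one_div_mul_cancel hp0.ne']

lemma lintegral_div_eLpNorm'_rpow_le_one {f : α → ℝ≥0∞} (hp : 0 < p) (hf : AEMeasurable f μ) :
    ∫⁻ x, (f x / eLpNorm' f p μ) ^ p ∂μ ≤ 1 := by
  simp only [ENNReal.div_rpow_of_nonneg _ _ hp.le]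
  simp only [div_eq_mul_inv]
  rw [lintegral_mul_const'' _ (hf.pow_const p), ← div_eq_mul_inv, eLpNorm'_eq_lintegral_enorm,
    ← ENNReal.rpow_mul, one_div_mul_cancel hp.ne', ENNReal.rpow_one]
  exact ENNReal.div_self_le_one

lemma ae_eq_eLpNorm'_mul_div {f : α → ℝ≥0∞} (hp : 0 < p) (hf : AEMeasurable f μ)
    (hfin : eLpNorm' f p μ ≠ ∞) :
    ∀ᵐ x ∂μ, f x = eLpNorm' f p μ * (f x / eLpNorm' f p μ) := by
  by_cases h0 : eLpNorm' f p μ = 0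
  · filter_upwards [(eLpNorm'_eq_zero_iff hp hf.aestronglyMeasurable).1 h0] with x hx
    simp [hx]
  · exact .of_forall fun x => (ENNReal.mul_div_cancel h0 hfin).symm

lemma eLpNorm'_const_mul_le {f : α → ℝ≥0∞} (hp : 0 < p) (hf : Measurable f) (c : ℝ≥0∞) :
    eLpNorm' (fun x => c * f x) p μ ≤ c * eLpNorm' f p μ :=
  eLpNorm'_le_mul_eLpNorm'_of_ae_le_mul hf.aestronglyMeasurable (.of_forall fun _ => le_rfl) hp

variable [SFinite μ] [SFinite ν] {K : α → β → ℝ≥0∞}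

lemma measurable_eLpNorm'_left (hK : Measurable (Function.uncurry K)) :
    Measurable fun x => eLpNorm' (K x) p ν := by
  have : Measurable fun x => ∫⁻ y, K x y ^ p ∂ν :=
    Measurable.lintegral_prod_right (f := fun x y => K x y ^ p) (hK.pow_const p)
  simpa only [eLpNorm'_eq_lintegral_enorm, enorm_eq_self] using this.pow_const (1 / p)

lemma ae_lintegral_eq_lintegral_eLpNorm'_mul (hp : 0 < p) (hK : Measurable (Function.uncurry K))
    (hfin : ∫⁻ x, eLpNorm' (K x) p ν ∂μ ≠ ∞) :
    ∀ᵐ y ∂ν, ∫⁻ x, K x y ∂μ =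
      ∫⁻ x, eLpNorm' (K x) p ν * (K x y / eLpNorm' (K x) p ν) ∂μ := by
  have hN := measurable_eLpNorm'_left (p := p) (ν := ν) hK
  have hN' : Measurable fun z : α × β => eLpNorm' (K z.1) p ν := hN.comp measurable_fst
  have hset : MeasurableSet
      {z : α × β | K z.1 z.2 = eLpNorm' (K z.1) p ν * (K z.1 z.2 / eLpNorm' (K z.1) p ν)} :=
    measurableSet_eq_fun hK (hN'.mul (hK.div hN'))
  have hae : ∀ᵐ x ∂μ, ∀ᵐ y ∂ν, K x y = eLpNorm' (K x) p ν * (K x y / eLpNorm' (K x) p ν) := by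
    filter_upwards [ae_lt_top hN hfin] with x hx
    exact ae_eq_eLpNorm'_mul_div hp hK.of_uncurry_left.aemeasurable hx.ne
  filter_upwards [(Measure.ae_ae_comm hset).1 hae] with y hy using lintegral_congr_ae hy

theorem eLpNorm'_lintegral_le (hp : 1 ≤ p) (hK : Measurable (Function.uncurry K)) :
    eLpNorm' (fun y => ∫⁻ x, K x y ∂μ) p ν ≤ ∫⁻ x, eLpNorm' (K x) p ν ∂μ := by
  have hp0 : 0 < p := by linarith
  set N : α → ℝ≥0∞ := fun x => eLpNorm' (K x) p ν
  have hN : Measurable N := measurable_eLpNorm'_left hK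
  by_cases hfin : ∫⁻ x, N x ∂μ = ∞
  · exact hfin ▸ le_top
  have hKx (x : α) : Measurable (K x) := hK.of_uncurry_left
  have hKy (y : β) : Measurable fun x => K x y := hK.of_uncurry_right
  have hpow : ∫⁻ y, (∫⁻ x, K x y ∂μ) ^ p ∂ν ≤ (∫⁻ x, N x ∂μ) ^ p := calc
    _ = ∫⁻ y, (∫⁻ x, N x * (K x y / N x) ∂μ) ^ p ∂ν := lintegral_congr_ae <| by
        filter_upwards [ae_lintegral_eq_lintegral_eLpNorm'_mul hp0 hK hfin] with y hy
        rw [hy]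
    _ ≤ ∫⁻ y, (∫⁻ x, N x ∂μ) ^ (p - 1) * ∫⁻ x, N x * (K x y / N x) ^ p ∂μ ∂ν :=
        lintegral_mono fun y =>
          rpow_lintegral_mul_le hp hN.aemeasurable ((hKy y).div hN).aemeasurable
    _ = (∫⁻ x, N x ∂μ) ^ (p - 1) * ∫⁻ x, N x * ∫⁻ y, (K x y / N x) ^ p ∂ν ∂μ := by
        have hN' : Measurable fun z : β × α => N z.2 := hN.comp measurable_snd
        have hjoint : Measurable fun z : β × α => N z.2 * (K z.2 z.1 / N z.2) ^ p :=
          hN'.mul (((hK.comp measurable_swap).div hN').pow_const p)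
        rw [lintegral_const_mul' _ _ (ENNReal.rpow_ne_top_of_nonneg (by linarith) hfin),
          lintegral_lintegral_swap hjoint.aemeasurable]
        congr 1
        exact lintegral_congr fun x =>
          lintegral_const_mul _ (((hKx x).div_const _).pow_const p)
    _ ≤ (∫⁻ x, N x ∂μ) ^ (p - 1) * ∫⁻ x, N x ∂μ := by
        gcongr with x
        exact mul_le_of_le_one_right'
          (lintegral_div_eLpNorm'_rpow_le_one hp0 (hKx x).aemeasurable)
    _ = (∫⁻ x, N x ∂μ) ^ p := by
        nth_rw 2 [← ENNReal.rpow_one (∫⁻ x, N x ∂μ)]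
        rw [← ENNReal.rpow_add_of_nonneg _ _ (by linarith) zero_le_one, sub_add_cancel]
  simpa only [eLpNorm'_eq_lintegral_enorm, enorm_eq_self, ← ENNReal.rpow_mul,
    mul_one_div_cancel hp0.ne', ENNReal.rpow_one] using
    ENNReal.rpow_le_rpow hpow (z := 1 / p) (by positivity)

end Minkowski

section Young

variable {G : Type*} [AddGroup G] [MeasurableSpace G] {μ : Measure G} {p : ℝ}

lemma measurable_lintegral_sub_mul [MeasurableSub₂ G] [SFinite μ] {f g : G → ℝ≥0∞}
    (hf : Measurable f) (hg : Measurable g) : Measurable fun y => ∫⁻ x, f (y - x) * g x ∂μ :=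
  Measurable.lintegral_prod_right (f := fun y x => f (y - x) * g x)
    ((hf.comp measurable_sub).mul (hg.comp measurable_snd))

variable [μ.IsAddRightInvariant]

lemma eLpNorm'_comp_sub_right [MeasurableAdd G] {f : G → ℝ≥0∞} (x : G) :
    eLpNorm' (fun y => f (y - x)) p μ = eLpNorm' f p μ := by
  simp only [eLpNorm'_eq_lintegral_enorm]
  rw [lintegral_sub_right_eq_self (fun y => ‖f y‖ₑ ^ p) x]

theorem eLpNorm'_convolution_le [MeasurableAdd₂ G] [MeasurableNeg G] [SFinite μ] {f g : G → ℝ≥0∞}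
    (hp : 1 ≤ p) (hf : Measurable f) (hg : Measurable g) :
    eLpNorm' (fun y => ∫⁻ x, f (y - x) * g x ∂μ) p μ ≤ eLpNorm' f p μ * ∫⁻ x, g x ∂μ := by
  have hf_sub : Measurable fun z : G × G => f (z.2 - z.1) :=
    hf.comp (measurable_snd.sub measurable_fst)
  have hK : Measurable (Function.uncurry fun x y => f (y - x) * g x) :=
    hf_sub.mul (hg.comp measurable_fst)
  refine (eLpNorm'_lintegral_le hp hK).trans ?_
  rw [← lintegral_const_mul _ hg]
  refine lintegral_mono fun x => ?_
  simp only [mul_comm _ (g x)]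
  rw [← eLpNorm'_comp_sub_right (f := f) x]
  exact eLpNorm'_const_mul_le (f := fun y => f (y - x)) (zero_lt_one.trans_le hp)
    (hf.comp (measurable_sub_const x)) _

end Young

section CutWeight

variable {E : Type*} [NormedAddCommGroup E]

/-- The radial weight `|x|^e min(1, |x|^{-σ})`: it behaves like `|x|^e` near the origin and like
`|x|^{e - σ}` at infinity. -/
noncomputable def cutWeight (e σ : ℝ) (x : E) : ℝ≥0∞ := ‖x‖ₑ ^ e * min 1 (‖x‖ₑ ^ (-σ))

lemma enorm_rpow_ne_zero {x : E} (hx : x ≠ 0) (s : ℝ) : ‖x‖ₑ ^ s ≠ 0 := by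
  simp [ENNReal.rpow_eq_zero_iff, hx]

lemma enorm_rpow_add {x : E} (hx : x ≠ 0) (s t : ℝ) : ‖x‖ₑ ^ (s + t) = ‖x‖ₑ ^ s * ‖x‖ₑ ^ t :=
  ENNReal.rpow_add s t (by simpa using hx) enorm_ne_top

lemma enorm_rpow_mul_cutWeight {x : E} (hx : x ≠ 0) (s e σ : ℝ) :
    ‖x‖ₑ ^ s * cutWeight e σ x = cutWeight (s + e) σ x := by
  rw [cutWeight, cutWeight, enorm_rpow_add hx, mul_assoc]

lemma cutWeight_rpow {x : E} {q : ℝ} (hq : 0 ≤ q) (e σ : ℝ) :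
    cutWeight e σ x ^ q = cutWeight (e * q) (σ * q) x := by
  rw [cutWeight, cutWeight, ENNReal.mul_rpow_of_nonneg _ _ hq,
    (ENNReal.monotone_rpow_of_nonneg hq).map_min, ENNReal.one_rpow, ← ENNReal.rpow_mul,
    ← ENNReal.rpow_mul, neg_mul]

lemma cutWeight_le_enorm_rpow (e σ : ℝ) (x : E) : cutWeight e σ x ≤ ‖x‖ₑ ^ e :=
  mul_le_of_le_one_right' (min_le_left _ _)

lemma cutWeight_le_enorm_rpow_sub {x : E} (hx : x ≠ 0) (e σ : ℝ) :
    cutWeight e σ x ≤ ‖x‖ₑ ^ (e - σ) := by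
  rw [sub_eq_add_neg, enorm_rpow_add hx]
  exact mul_le_mul_right (min_le_right _ _) _

lemma cutWeight_le_of_comparable {e σ : ℝ} (he : 0 ≤ e) (hσ : 0 ≤ σ) {a : ℝ≥0∞} (ha : 1 ≤ a)
    (ha' : a ≠ ∞) {y z : E} (hyz : ‖y‖ₑ ≤ a * ‖z‖ₑ) (hzy : ‖z‖ₑ ≤ a * ‖y‖ₑ) :
    cutWeight e σ y ≤ a ^ (e + σ) * cutWeight e σ z := by
  have hinv : (‖y‖ₑ ^ σ)⁻¹ ≤ a ^ σ * (‖z‖ₑ ^ σ)⁻¹ := by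
    have ha0 : a ^ σ ≠ 0 := by simp [(zero_lt_one.trans_le ha).ne', ha']
    have ha_top : a ^ σ ≠ ∞ := ENNReal.rpow_ne_top_of_nonneg hσ ha'
    calc (‖y‖ₑ ^ σ)⁻¹ = a ^ σ * (a ^ σ * ‖y‖ₑ ^ σ)⁻¹ := by
          rw [ENNReal.mul_inv (.inl ha0) (.inl ha_top), ← mul_assoc,
            ENNReal.mul_inv_cancel ha0 ha_top, one_mul]
      _ ≤ a ^ σ * (‖z‖ₑ ^ σ)⁻¹ := by
          rw [← ENNReal.mul_rpow_of_nonneg _ _ hσ]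
          gcongr
  have hone : 1 ≤ a ^ σ := by simpa using ENNReal.rpow_le_rpow ha hσ
  calc cutWeight e σ y ≤ (a * ‖z‖ₑ) ^ e * (a ^ σ * min 1 (‖z‖ₑ ^ (-σ))) := by
        rw [cutWeight, mul_min (a ^ σ), mul_one, ENNReal.rpow_neg, ENNReal.rpow_neg]
        exact mul_le_mul' (ENNReal.rpow_le_rpow hyz he) (min_le_min hone hinv)
    _ = a ^ (e + σ) * cutWeight e σ z := by
      rw [ENNReal.mul_rpow_of_nonneg _ _ he, ENNReal.rpow_add_of_nonneg _ _ he hσ, cutWeight]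
      ring

lemma cutWeight_le_cutWeight_zero {ρ σ : ℝ} (hρ : 0 ≤ ρ) (hσ : ρ ≤ σ) {x z : E} (hz : z ≠ 0)
    (hxz : ‖x‖ₑ ≤ ‖z‖ₑ) : cutWeight ρ σ z ≤ cutWeight 0 (σ - ρ) x := by
  rw [cutWeight.eq_1 0, ENNReal.rpow_zero, one_mul]
  have hpow : ‖z‖ₑ ^ (ρ - σ) ≤ ‖x‖ₑ ^ (-(σ - ρ)) := by
    rw [← neg_sub, ENNReal.rpow_neg, ENNReal.rpow_neg, ENNReal.inv_le_inv]
    exact ENNReal.rpow_le_rpow hxz (by linarith)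
  refine le_min ?_ ((cutWeight_le_enorm_rpow_sub hz ρ σ).trans hpow)
  rcases le_total ‖z‖ₑ 1 with h | h
  · exact (cutWeight_le_enorm_rpow ρ σ z).trans (ENNReal.rpow_le_one h hρ)
  · exact (cutWeight_le_enorm_rpow_sub hz ρ σ).trans
      ((ENNReal.rpow_le_rpow_of_exponent_le h (by linarith)).trans_eq ENNReal.rpow_zero)

variable [MeasurableSpace E] [BorelSpace E]

@[fun_prop]
lemma measurable_cutWeight (e σ : ℝ) : Measurable (cutWeight (E := E) e σ) := by
  unfold cutWeight
  fun_prop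

variable [NormedSpace ℝ E] [FiniteDimensional ℝ E] {μ : Measure E} [μ.IsAddHaarMeasure]

lemma lintegral_comp_smul_of_pos (f : E → ℝ≥0∞) {r : ℝ} (hr : 0 < r) :
    ∫⁻ x, f (r • x) ∂μ = ENNReal.ofReal r ^ (-(finrank ℝ E : ℝ)) * ∫⁻ x, f x ∂μ := by
  have hemb : MeasurableEmbedding (fun x : E => r • x) :=
    (Homeomorph.smul (isUnit_iff_ne_zero.2 hr.ne').unit).measurableEmbedding
  rw [← hemb.lintegral_map f, Measure.map_addHaar_smul _ hr.ne', lintegral_smul_measure,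
    smul_eq_mul, abs_of_pos (by positivity), ENNReal.ofReal_inv_of_pos (by positivity),
    ENNReal.rpow_neg, ENNReal.rpow_natCast, ENNReal.ofReal_pow hr.le]

lemma eLpNorm'_comp_smul_of_pos (f : E → ℝ≥0∞) {p r : ℝ} (hp : 0 ≤ p) (hr : 0 < r) :
    eLpNorm' (fun x => f (r • x)) p μ =
      ENNReal.ofReal r ^ (-(finrank ℝ E / p)) * eLpNorm' f p μ := by
  simp only [eLpNorm'_eq_lintegral_enorm, enorm_eq_self]
  rw [lintegral_comp_smul_of_pos (fun x => f x ^ p) hr,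
    ENNReal.mul_rpow_of_nonneg _ _ (by positivity), ← ENNReal.rpow_mul, neg_mul, mul_one_div]

lemma setLIntegral_norm_ge_enorm_rpow_mul {r : ℝ} (hr : 0 < r) (a s : ℝ) :
    ∫⁻ x in {x | r * a ≤ ‖x‖}, ‖x‖ₑ ^ s ∂μ =
      ENNReal.ofReal r ^ (finrank ℝ E + s) * ∫⁻ x in {x | a ≤ ‖x‖}, ‖x‖ₑ ^ s ∂μ := by
  have hr0 : ENNReal.ofReal r ≠ 0 := by simpa using hr
  have hset (b : ℝ) : MeasurableSet {x : E | b ≤ ‖x‖} :=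
    measurableSet_le (by fun_prop) (by fun_prop)
  have hscale (x : E) : {x : E | r * a ≤ ‖x‖}.indicator (fun x => ‖x‖ₑ ^ s) (r • x) =
      ENNReal.ofReal r ^ s * {x : E | a ≤ ‖x‖}.indicator (fun x => ‖x‖ₑ ^ s) x := by
    have hmem : r • x ∈ {x : E | r * a ≤ ‖x‖} ↔ x ∈ {x : E | a ≤ ‖x‖} := by
      simp [norm_smul, abs_of_pos hr, hr]
    simp only [Set.indicator, hmem, enorm_smul, Real.enorm_eq_ofReal hr.le,
      ENNReal.mul_rpow_of_ne_top ENNReal.ofReal_ne_top enorm_ne_top, mul_ite, mul_zero]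
  have hsub := lintegral_comp_smul_of_pos (μ := μ)
    ({x : E | r * a ≤ ‖x‖}.indicator fun x => ‖x‖ₑ ^ s) hr
  simp only [hscale] at hsub
  rw [lintegral_const_mul _ ((by fun_prop : Measurable fun x : E => ‖x‖ₑ ^ s).indicator (hset a)),
    lintegral_indicator (hset _), lintegral_indicator (hset _)] at hsub
  rw [ENNReal.rpow_add _ _ hr0 ENNReal.ofReal_ne_top, mul_assoc, hsub, ← mul_assoc,
    ← ENNReal.rpow_add _ _ hr0 ENNReal.ofReal_ne_top, add_neg_cancel, ENNReal.rpow_zero, one_mul]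

lemma setLIntegral_norm_ge_enorm_rpow_lt_top {a s : ℝ} (ha : 0 < a)
    (hs : s < -(finrank ℝ E : ℝ)) : ∫⁻ x in {x | a ≤ ‖x‖}, ‖x‖ₑ ^ s ∂μ < ∞ := by
  have hs0 : s ≤ 0 := by linarith [(finrank ℝ E).cast_nonneg (α := ℝ)]
  have hjap := finite_integral_one_add_norm (μ := μ) (r := -s) (by linarith)
  refine lt_of_le_of_lt ?_ (ENNReal.mul_lt_top
    (ENNReal.ofReal_lt_top (r := (1 / a + 1) ^ (-s))) hjap)
  rw [neg_neg, ← lintegral_const_mul' _ _ ENNReal.ofReal_ne_top,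
    ← lintegral_indicator (measurableSet_le (by fun_prop) (by fun_prop))]
  refine lintegral_mono fun x => Set.indicator_apply_le' (fun hx => ?_) fun _ => zero_le
  replace hx : a ≤ ‖x‖ := hx
  have hx0 : 0 < ‖x‖ := ha.trans_le hx
  have hcmp : 1 + ‖x‖ ≤ (1 / a + 1) * ‖x‖ := by
    rw [add_mul, one_mul, one_div_mul_eq_div]
    gcongr
    rwa [one_le_div ha]
  rw [← ENNReal.ofReal_mul (by positivity), ← ofReal_norm, ENNReal.ofReal_rpow_of_pos hx0,
    Real.rpow_neg (by positivity), ← div_eq_inv_mul]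
  apply ENNReal.ofReal_le_ofReal
  rw [le_div_iff₀ (by positivity), mul_comm, ← Real.mul_rpow (by positivity) hx0.le]
  exact Real.rpow_le_rpow_of_nonpos (by positivity) hcmp hs0

variable [Nontrivial E]

lemma setLIntegral_norm_lt_one_enorm_rpow_lt_top {s : ℝ} (hs : -(finrank ℝ E : ℝ) < s) :
    ∫⁻ x in {x | ‖x‖ < 1}, ‖x‖ₑ ^ s ∂μ < ∞ := by
  have h := integrableOn_ball_of_norm_le_rpow (μ := μ)
    (f := fun x => ‖x‖ ^ s) (C := 1) (α := -s) (r := 1) finrank_pos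
    (by linarith)
    (by filter_upwards with x; simp [abs_of_nonneg (Real.rpow_nonneg (norm_nonneg x) s)])
    (measurable_norm.pow_const s).aestronglyMeasurable
  have : Metric.ball (0 : E) 1 = {x | ‖x‖ < 1} := by ext; simp
  refine lt_of_eq_of_lt ?_ h.2
  rw [this]
  refine lintegral_congr_ae ?_
  filter_upwards [ae_restrict_of_ae (Measure.ae_ne μ 0)] with x hx
  rw [Real.enorm_eq_ofReal (by positivity), ← ENNReal.ofReal_rpow_of_pos (norm_pos_iff.2 hx),
    ofReal_norm]

lemma lintegral_cutWeight_lt_top {e σ : ℝ} (he : -(finrank ℝ E : ℝ) < e)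
    (hσ : e - σ < -(finrank ℝ E : ℝ)) : ∫⁻ x, cutWeight e σ x ∂μ < ∞ := by
  have hball : MeasurableSet {x : E | ‖x‖ < 1} := measurableSet_lt (by fun_prop) (by fun_prop)
  have hcompl : {x : E | ‖x‖ < 1}ᶜ = {x | 1 ≤ ‖x‖} := by ext; simp
  rw [← lintegral_add_compl _ hball, hcompl]
  refine ENNReal.add_lt_top.2 ⟨?_, ?_⟩
  · exact (setLIntegral_mono (by fun_prop) fun x _ => cutWeight_le_enorm_rpow e σ x).trans_lt
      (setLIntegral_norm_lt_one_enorm_rpow_lt_top he)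
  · refine (setLIntegral_mono (by fun_prop) fun x hx => ?_).trans_lt
      (setLIntegral_norm_ge_enorm_rpow_lt_top one_pos hσ)
    exact cutWeight_le_enorm_rpow_sub (norm_pos_iff.1 (one_pos.trans_le hx)) e σ

lemma eLpNorm'_cutWeight_ne_top {e σ q : ℝ} (hq : 0 < q) (he : 0 < e + finrank ℝ E / q)
    (hσ : e + finrank ℝ E / q < σ) : eLpNorm' (cutWeight e σ) q μ ≠ ∞ := by
  have hcancel : (e + finrank ℝ E / q) * q = e * q + finrank ℝ E := by
    rw [add_mul, div_mul_cancel₀ _ hq.ne']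
  have hlow := hcancel ▸ mul_pos he hq
  have hupp := hcancel ▸ mul_lt_mul_of_pos_right hσ hq
  simp only [eLpNorm'_eq_lintegral_enorm, enorm_eq_self, cutWeight_rpow hq.le]
  exact ENNReal.rpow_ne_top_of_nonneg (by positivity)
    (lintegral_cutWeight_lt_top (by linarith) (by linarith)).ne

end CutWeight

section WeightedConvolution

variable {E : Type*} [NormedAddCommGroup E] {ν p : ℝ}

lemma weight_exponent_pos {n : ℕ} (hp : 2 < p) (hν : n * (1 - 2 / p) < 2 * ν) : 0 < ν := by
  have : 0 ≤ n * (1 - 2 / p) :=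
    mul_nonneg n.cast_nonneg (sub_nonneg.2 ((div_le_one (by linarith)).2 hp.le))
  linarith

lemma cutWeight_le_of_norm_le {ρ σ : ℝ} (hν : 0 ≤ ν) (hρ : 0 ≤ ρ) (hσ : ρ ≤ σ) {x y z : E}
    (hz : z ≠ 0) (hyz : ‖y‖ ≤ 2 * ‖z‖) (hzy : ‖z‖ ≤ 2 * ‖y‖) (hxz : ‖x‖ ≤ ‖z‖) :
    cutWeight (ν + ρ) σ y ≤ 2 ^ (ν + ρ + σ) * (‖z‖ₑ ^ ν * cutWeight 0 (σ - ρ) x) := by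
  have henorm {u v : E} (h : ‖u‖ ≤ 2 * ‖v‖) : ‖u‖ₑ ≤ 2 * ‖v‖ₑ := by
    rw [← ofReal_norm, ← ofReal_norm, ← ENNReal.ofReal_ofNat, ← ENNReal.ofReal_mul zero_le_two]
    exact ENNReal.ofReal_le_ofReal h
  refine (cutWeight_le_of_comparable (by positivity) (hρ.trans hσ) one_le_two
    ENNReal.ofNat_ne_top (henorm hyz) (henorm hzy)).trans ?_
  rw [← enorm_rpow_mul_cutWeight hz]
  gcongr
  exact cutWeight_le_cutWeight_zero hρ hσ hz (enorm_le_iff_norm_le.2 hxz)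

/-- The three regions `2|x| ≤ |y|`, `2|z| ≤ |y|` and the remaining one, where both `x` and `z` are
at least comparable to `y = x + z`. -/
lemma cutWeight_add_mul_le {ρ σ : ℝ} (hν : 0 ≤ ν) (hρ : 0 ≤ ρ) (hσ : ρ ≤ σ) (F G : E → ℝ≥0∞)
    {x z : E} (hx : x ≠ 0) (hz : z ≠ 0) :
    cutWeight (ν + ρ) σ (x + z) * (F z * G x) ≤
      2 ^ (ν + ρ + σ) * (‖z‖ₑ ^ ν * F z * (cutWeight 0 (σ - ρ) x * G x)) +
      2 ^ (ν + ρ + σ) * (cutWeight 0 (σ - ρ) z * F z * (‖x‖ₑ ^ ν * G x)) +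
      cutWeight (ν + ρ) σ (x + z) * ({w | ‖x + z‖ / 2 ≤ ‖w‖}.indicator F z *
        {w | ‖x + z‖ / 2 ≤ ‖w‖}.indicator G x) := by
  have htri := norm_add_le x z
  have hx_le : ‖x‖ ≤ ‖x + z‖ + ‖z‖ := by simpa using norm_sub_le (x + z) z
  have hz_le : ‖z‖ ≤ ‖x + z‖ + ‖x‖ := by simpa using norm_sub_le (x + z) x
  by_cases hxy : ‖x + z‖ / 2 ≤ ‖x‖
  · by_cases hzy : ‖x + z‖ / 2 ≤ ‖z‖
    · refine le_add_left (le_of_eq ?_)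
      rw [Set.indicator_of_mem (show z ∈ {w | _ ≤ ‖w‖} from hzy),
        Set.indicator_of_mem (show x ∈ {w | _ ≤ ‖w‖} from hxy)]
    · refine le_add_right (le_add_left ?_)
      calc _ ≤ 2 ^ (ν + ρ + σ) * (‖x‖ₑ ^ ν * cutWeight 0 (σ - ρ) z) * (F z * G x) := by
            gcongr
            exact cutWeight_le_of_norm_le hν hρ hσ hx (by linarith) (by linarith) (by linarith)
        _ = _ := by ring
  · refine le_add_right (le_add_right ?_)
    calc _ ≤ 2 ^ (ν + ρ + σ) * (‖z‖ₑ ^ ν * cutWeight 0 (σ - ρ) x) * (F z * G x) := by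
          gcongr
          exact cutWeight_le_of_norm_le hν hρ hσ hz (by linarith) (by linarith) (by linarith)
      _ = _ := by ring

variable [MeasurableSpace E] {μ : Measure E}

/-- The `L^p` norm with the power weight `|x|^ν`. -/
noncomputable def powNorm (μ : Measure E) (ν p : ℝ) (F : E → ℝ≥0∞) : ℝ≥0∞ :=
  eLpNorm' (fun x => ‖x‖ₑ ^ ν * F x) p μ

lemma lintegral_convolution_comm [BorelSpace E] [μ.IsAddLeftInvariant] [μ.IsNegInvariant]
    (F G : E → ℝ≥0∞) (y : E) :
    ∫⁻ x, F (y - x) * G x ∂μ = ∫⁻ x, G (y - x) * F x ∂μ := by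
  rw [← lintegral_sub_left_eq_self _ y]
  simp only [sub_sub_cancel, mul_comm]

variable [BorelSpace E] [NormedSpace ℝ E] [FiniteDimensional ℝ E]
  [μ.IsAddHaarMeasure] {F G : E → ℝ≥0∞}

lemma eLpNorm'_tail_enorm_rpow {q : ℝ} (hq : 0 < q) (s : ℝ) {y : E} (hy : y ≠ 0) :
    eLpNorm' (fun x : E => ‖x‖ₑ ^ s) q (μ.restrict {x | ‖y‖ / 2 ≤ ‖x‖}) =
      ‖y‖ₑ ^ (finrank ℝ E / q + s) *
        eLpNorm' (fun x : E => ‖x‖ₑ ^ s) q (μ.restrict {x | 2⁻¹ ≤ ‖x‖}) := by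
  simp only [eLpNorm'_eq_lintegral_enorm, enorm_eq_self, ← ENNReal.rpow_mul, div_eq_mul_inv ‖y‖]
  rw [setLIntegral_norm_ge_enorm_rpow_mul (norm_pos_iff.2 hy), ofReal_norm,
    ENNReal.mul_rpow_of_nonneg _ _ (by positivity), ← ENNReal.rpow_mul]
  congr 2
  field_simp

variable [Nontrivial E]

lemma lintegral_cutWeight_zero_mul_le {q : ℝ} (hpq : q.HolderConjugate p) (s : ℝ)
    (hG : Measurable G) :
    ∫⁻ x, cutWeight 0 s x * G x ∂μ ≤ eLpNorm' (cutWeight (-ν) s) q μ * powNorm μ ν p G := by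
  have hsplit : ∀ᵐ x ∂μ, cutWeight 0 s x * G x = cutWeight (-ν) s x * (‖x‖ₑ ^ ν * G x) := by
    filter_upwards [Measure.ae_ne μ 0] with x hx
    rw [← add_neg_cancel ν, ← enorm_rpow_mul_cutWeight hx]
    ring
  rw [lintegral_congr_ae hsplit]
  exact ENNReal.lintegral_mul_le_Lp_mul_Lq μ hpq (by fun_prop) (by fun_prop)

lemma eLpNorm'_restrict_le_powNorm_mul {m q : ℝ} (hm : 0 < m) (hmp : m < p)
    (hq : 1 / m = 1 / p + 1 / q) (hF : Measurable F) (S : Set E) :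
    eLpNorm' F m (μ.restrict S) ≤
      powNorm μ ν p F * eLpNorm' (fun x => ‖x‖ₑ ^ (-ν)) q (μ.restrict S) := by
  have hsplit : ∀ᵐ x ∂μ.restrict S, F x = ‖x‖ₑ ^ ν * F x * ‖x‖ₑ ^ (-ν) := by
    filter_upwards [ae_restrict_of_ae (Measure.ae_ne μ 0)] with x hx
    rw [mul_right_comm, ← enorm_rpow_add hx, add_neg_cancel, ENNReal.rpow_zero, one_mul]
  rw [eLpNorm'_congr_ae hsplit]
  refine (ENNReal.lintegral_Lp_mul_le_Lq_mul_Lr hm hmp hq _ (by fun_prop) (by fun_prop)).trans ?_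
  refine mul_le_mul_left (ENNReal.rpow_le_rpow ?_ (by have := hm.trans hmp; positivity)) _
  exact setLIntegral_le_lintegral _ _

lemma exists_eLpNorm'_tail_le {m : ℝ} (hm : 0 < m) (hmp : m < p)
    (hν : finrank ℝ E * (1 / m - 1 / p) < ν) :
    ∃ C : ℝ≥0∞, C ≠ ∞ ∧ ∀ F : E → ℝ≥0∞, Measurable F → ∀ y : E, y ≠ 0 →
      eLpNorm' F m (μ.restrict {x | ‖y‖ / 2 ≤ ‖x‖}) ≤
        C * ‖y‖ₑ ^ (finrank ℝ E * (1 / m - 1 / p) - ν) * powNorm μ ν p F := by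
  obtain ⟨q, hq, hq0⟩ : ∃ q : ℝ, 1 / q = 1 / m - 1 / p ∧ 0 < q :=
    ⟨1 / (1 / m - 1 / p), one_div_one_div _,
      one_div_pos.2 (sub_pos.2 (one_div_lt_one_div_of_lt hm hmp))⟩
  have hνq : -ν * q < -(finrank ℝ E : ℝ) := by
    rwa [neg_mul, neg_lt_neg_iff, ← div_lt_iff₀ hq0, ← mul_one_div, hq]
  refine ⟨eLpNorm' (fun x : E => ‖x‖ₑ ^ (-ν)) q (μ.restrict {x | 2⁻¹ ≤ ‖x‖}), ?_,
    fun F hF y hy => ?_⟩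
  · simp only [eLpNorm'_eq_lintegral_enorm, enorm_eq_self, ← ENNReal.rpow_mul]
    exact ENNReal.rpow_ne_top_of_nonneg (by positivity)
      (setLIntegral_norm_ge_enorm_rpow_lt_top (by norm_num) hνq).ne
  · refine (eLpNorm'_restrict_le_powNorm_mul (ν := ν) hm hmp (by rw [hq]; ring) hF _).trans_eq ?_
    rw [eLpNorm'_tail_enorm_rpow hq0 _ hy, ← hq, mul_one_div, sub_eq_add_neg]
    ring

lemma exists_tail_convolution_le (hp : 2 < p) (hν : finrank ℝ E * (1 - 2 / p) < 2 * ν) :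
    ∃ C : ℝ≥0∞, C ≠ ∞ ∧ ∀ F G : E → ℝ≥0∞, Measurable F → Measurable G → ∀ y : E, y ≠ 0 →
      ∫⁻ x, {w | ‖y‖ / 2 ≤ ‖w‖}.indicator F (y - x) * {w | ‖y‖ / 2 ≤ ‖w‖}.indicator G x ∂μ ≤
        C * ‖y‖ₑ ^ (finrank ℝ E * (1 - 2 / p) - 2 * ν) *
          (powNorm μ ν p F * powNorm μ ν p G) := by
  have hν2 : finrank ℝ E * (1 / 2 - 1 / p) < ν := by
    have : finrank ℝ E * (1 / 2 - 1 / p) = finrank ℝ E * (1 - 2 / p) / 2 := by ring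
    linarith
  obtain ⟨C, hC, htail⟩ := exists_eLpNorm'_tail_le (μ := μ) two_pos hp hν2
  refine ⟨C * C, ENNReal.mul_ne_top hC hC, fun F G hF hG y hy => ?_⟩
  set S : Set E := {w | ‖y‖ / 2 ≤ ‖w‖}
  have hS : MeasurableSet S := measurableSet_le (by fun_prop) (by fun_prop)
  have hrestrict (H : E → ℝ≥0∞) :
      (∫⁻ x, S.indicator H x ^ (2 : ℝ) ∂μ) ^ (1 / (2 : ℝ)) = eLpNorm' H 2 (μ.restrict S) := by
    rw [eLpNorm'_eq_lintegral_enorm, ← lintegral_indicator hS]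
    congr 2 with x
    by_cases hx : x ∈ S <;> simp [hx]
  calc _ ≤ (∫⁻ x, S.indicator F (y - x) ^ (2 : ℝ) ∂μ) ^ (1 / (2 : ℝ)) *
        (∫⁻ x, S.indicator G x ^ (2 : ℝ) ∂μ) ^ (1 / (2 : ℝ)) :=
        ENNReal.lintegral_mul_le_Lp_mul_Lq μ .two_two
          ((hF.indicator hS).comp (measurable_const.sub measurable_id)).aemeasurable
          (hG.indicator hS).aemeasurable
    _ = eLpNorm' F 2 (μ.restrict S) * eLpNorm' G 2 (μ.restrict S) := by
        rw [lintegral_sub_left_eq_self (fun x => S.indicator F x ^ (2 : ℝ)) y, hrestrict,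
          hrestrict]
    _ ≤ (C * ‖y‖ₑ ^ (finrank ℝ E * (1 / 2 - 1 / p) - ν) * powNorm μ ν p F) *
        (C * ‖y‖ₑ ^ (finrank ℝ E * (1 / 2 - 1 / p) - ν) * powNorm μ ν p G) :=
        mul_le_mul' (htail F hF y hy) (htail G hG y hy)
    _ = _ := by
        rw [show finrank ℝ E * (1 - 2 / p) - 2 * ν = (finrank ℝ E * (1 / 2 - 1 / p) - ν) +
          (finrank ℝ E * (1 / 2 - 1 / p) - ν) by ring, enorm_rpow_add hy]
        ring

lemma cutWeight_mul_convolution_le {ρ σ : ℝ} (hν : 0 ≤ ν) (hρ : 0 ≤ ρ) (hσ : ρ ≤ σ)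
    {F G : E → ℝ≥0∞} (hF : Measurable F) (hG : Measurable G) (y : E) :
    cutWeight (ν + ρ) σ y * ∫⁻ x, F (y - x) * G x ∂μ ≤
      2 ^ (ν + ρ + σ) *
          ∫⁻ x, ‖y - x‖ₑ ^ ν * F (y - x) * (cutWeight 0 (σ - ρ) x * G x) ∂μ +
        2 ^ (ν + ρ + σ) *
          ∫⁻ x, ‖y - x‖ₑ ^ ν * G (y - x) * (cutWeight 0 (σ - ρ) x * F x) ∂μ +
        cutWeight (ν + ρ) σ y * ∫⁻ x, {w | ‖y‖ / 2 ≤ ‖w‖}.indicator F (y - x) *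
          {w | ‖y‖ / 2 ≤ ‖w‖}.indicator G x ∂μ := by
  have hS : MeasurableSet {w : E | ‖y‖ / 2 ≤ ‖w‖} := measurableSet_le (by fun_prop) (by fun_prop)
  have hF' := hF.indicator hS
  have hG' := hG.indicator hS
  have hswap := lintegral_convolution_comm (μ := μ) (fun w => ‖w‖ₑ ^ ν * G w)
    (fun x => cutWeight 0 (σ - ρ) x * F x) y
  rw [hswap, ← lintegral_const_mul _ (by fun_prop), ← lintegral_const_mul _ (by fun_prop),
    ← lintegral_const_mul _ (by fun_prop), ← lintegral_const_mul _ (by fun_prop),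
    ← lintegral_add_left (by fun_prop), ← lintegral_add_left (by fun_prop)]
  refine lintegral_mono_ae ?_
  filter_upwards [Measure.ae_ne μ 0, Measure.ae_ne μ y] with x hx hxy
  simpa only [add_sub_cancel] using
    cutWeight_add_mul_le hν hρ hσ F G hx (sub_ne_zero.2 hxy.symm)

lemma eLpNorm'_near_convolution_le (hp : 1 < p) (s : ℝ) {F G : E → ℝ≥0∞} (hF : Measurable F)
    (hG : Measurable G) :
    eLpNorm' (fun y => ∫⁻ x, ‖y - x‖ₑ ^ ν * F (y - x) * (cutWeight 0 s x * G x) ∂μ) p μ ≤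
      eLpNorm' (cutWeight (-ν) s) p.conjExponent μ * (powNorm μ ν p F * powNorm μ ν p G) := by
  refine (eLpNorm'_convolution_le (f := fun x => ‖x‖ₑ ^ ν * F x)
    (g := fun x => cutWeight 0 s x * G x) hp.le (by fun_prop) (by fun_prop)).trans ?_
  rw [mul_left_comm]
  exact mul_le_mul_right
    (lintegral_cutWeight_zero_mul_le (Real.HolderConjugate.conjExponent hp).symm _ hG) _

lemma eLpNorm'_cutWeight_mul_convolution_le {ρ σ e : ℝ} (hp : 1 < p) (hν : 0 ≤ ν) (hρ : 0 ≤ ρ)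
    (hσ : ρ ≤ σ) {F G : E → ℝ≥0∞} (hF : Measurable F) (hG : Measurable G) {T M : ℝ≥0∞}
    (htail : ∀ y : E, y ≠ 0 → ∫⁻ x, {w | ‖y‖ / 2 ≤ ‖w‖}.indicator F (y - x) *
      {w | ‖y‖ / 2 ≤ ‖w‖}.indicator G x ∂μ ≤ T * ‖y‖ₑ ^ e * M) :
    eLpNorm' (fun y => cutWeight (ν + ρ) σ y * ∫⁻ x, F (y - x) * G x ∂μ) p μ ≤
      2 * 2 ^ (ν + ρ + σ) * eLpNorm' (cutWeight (-ν) (σ - ρ)) p.conjExponent μ *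
          (powNorm μ ν p F * powNorm μ ν p G) +
        T * eLpNorm' (cutWeight (e + (ν + ρ)) σ) p μ * M := by
  have hp0 : 0 < p := by linarith
  set near := fun F G : E → ℝ≥0∞ => fun y =>
    ∫⁻ x, ‖y - x‖ₑ ^ ν * F (y - x) * (cutWeight 0 (σ - ρ) x * G x) ∂μ
  have hnear_meas {F G : E → ℝ≥0∞} (hF : Measurable F) (hG : Measurable G) :
      Measurable (near F G) := by
    exact measurable_lintegral_sub_mul (f := fun z => ‖z‖ₑ ^ ν * F z)
      (g := fun x => cutWeight 0 (σ - ρ) x * G x) (by fun_prop) (by fun_prop)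
  have hpointwise : ∀ᵐ y ∂μ, cutWeight (ν + ρ) σ y * ∫⁻ x, F (y - x) * G x ∂μ ≤
      2 ^ (ν + ρ + σ) * near F G y + 2 ^ (ν + ρ + σ) * near G F y +
        T * M * cutWeight (e + (ν + ρ)) σ y := by
    filter_upwards [Measure.ae_ne μ 0] with y hy
    refine (cutWeight_mul_convolution_le hν hρ hσ hF hG y).trans (add_le_add_right ?_ _)
    refine (mul_le_mul_right (htail y hy) _).trans_eq ?_
    rw [← enorm_rpow_mul_cutWeight hy e]
    ring
  have hadd {f g : E → ℝ≥0∞} (hf : Measurable f) (hg : Measurable g) :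
      eLpNorm' (fun x => f x + g x) p μ ≤ eLpNorm' f p μ + eLpNorm' g p μ :=
    eLpNorm'_add_le hf.aestronglyMeasurable hg.aestronglyMeasurable hp.le
  have hFG := hnear_meas hF hG
  have hGF := hnear_meas hG hF
  calc _ ≤ _ := eLpNorm'_mono_enorm_ae hp0.le hpointwise
    _ ≤ _ := (hadd (by fun_prop) (by fun_prop)).trans
      (add_le_add_left (hadd (by fun_prop) (by fun_prop)) _)
    _ ≤ _ := add_le_add (add_le_add
        ((eLpNorm'_const_mul_le hp0 hFG _).trans
          (mul_le_mul_right (eLpNorm'_near_convolution_le hp _ hF hG) _))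
        ((eLpNorm'_const_mul_le hp0 hGF _).trans
          (mul_le_mul_right (eLpNorm'_near_convolution_le hp _ hG hF) _)))
        (eLpNorm'_const_mul_le hp0 (by fun_prop) _)
    _ = _ := by ring

/-- Splitting the convolution at `|x|, |y - x| ≥ |y| / 2`: the near parts are bounded by Young's
inequality and Hölder's inequality, the tail pointwise by the Cauchy-Schwarz inequality. -/
lemma exists_eLpNorm'_cutWeight_mul_convolution_le {ρ σ : ℝ} (hp : 2 < p)
    (hν : finrank ℝ E * (1 - 2 / p) < 2 * ν) (hν' : ν < finrank ℝ E * (1 - 1 / p)) (hρ : 0 ≤ ρ)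
    (hσ : ρ + (finrank ℝ E * (1 - 1 / p) - ν) < σ) :
    ∃ C : ℝ≥0∞, C ≠ ∞ ∧ ∀ F G : E → ℝ≥0∞, Measurable F → Measurable G →
      eLpNorm' (fun y => cutWeight (ν + ρ) σ y * ∫⁻ x, F (y - x) * G x ∂μ) p μ ≤
        C * (powNorm μ ν p F * powNorm μ ν p G) := by
  have hp0 : 0 < p := by linarith
  have hν0 : 0 ≤ ν := (weight_exponent_pos hp hν).le
  obtain ⟨T, hT, htail⟩ := exists_tail_convolution_le (μ := μ) hp hν
  set K := eLpNorm' (cutWeight (-ν) (σ - ρ)) p.conjExponent μ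
  set L := eLpNorm' (cutWeight (finrank ℝ E * (1 - 2 / p) - 2 * ν + (ν + ρ)) σ) p μ
  have hpq := Real.HolderConjugate.conjExponent (by linarith : 1 < p)
  have hK : K ≠ ∞ := by
    have hd : finrank ℝ E / p.conjExponent = finrank ℝ E * (1 - 1 / p) := by
      rw [div_eq_mul_inv, ← hpq.one_sub_inv, one_div]
    exact eLpNorm'_cutWeight_ne_top hpq.symm.pos (by linarith) (by linarith)
  have hL : L ≠ ∞ := by
    have hd : finrank ℝ E * (1 - 2 / p) - 2 * ν + (ν + ρ) + finrank ℝ E / p =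
        finrank ℝ E * (1 - 1 / p) - ν + ρ := by ring
    exact eLpNorm'_cutWeight_ne_top hp0 (by linarith) (by linarith)
  refine ⟨2 * 2 ^ (ν + ρ + σ) * K + T * L, by finiteness, fun F G hF hG => ?_⟩
  refine (eLpNorm'_cutWeight_mul_convolution_le (by linarith) hν0 hρ (by linarith) hF hG
    (htail F G hF hG)).trans_eq ?_
  ring

end WeightedConvolution

section Majorant

variable {E : Type*} [NormedAddCommGroup E] {ν p γ B : ℝ}

lemma exp_neg_le_rpow_neg {u θ : ℝ} (hu : 0 < u) (hθ0 : 0 ≤ θ) (hθ1 : θ ≤ 1) :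
    Real.exp (-u) ≤ u ^ (-θ) := by
  rw [Real.exp_neg, Real.rpow_neg hu.le]
  refine inv_anti₀ (by positivity) ?_
  rcases le_total u 1 with h | h
  · exact (Real.rpow_le_one hu.le h hθ0).trans (Real.one_le_exp hu.le)
  · calc u ^ θ ≤ u ^ (1 : ℝ) := Real.rpow_le_rpow_of_exponent_le h hθ1
      _ ≤ Real.exp u := by rw [Real.rpow_one]; linarith [Real.add_one_le_exp u]

lemma ofReal_exp_mul_one_sub_rpow_le {t τ : ℝ} (hγ : 1 ≤ γ) (hτ0 : 0 ≤ τ) (hτ : τ ≤ γ)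
    (ht : t ∈ Set.Ioc 1 B) {η : E} (hη : η ≠ 0) :
    ENNReal.ofReal (Real.exp (‖η‖ ^ γ * (1 - t ^ γ))) ≤
      ENNReal.ofReal (B ^ (τ / γ) * (t - 1) ^ (-(τ / γ))) * min 1 (‖η‖ₑ ^ (-τ)) := by
  have hγ0 : 0 < γ := by linarith
  have ht0 : 0 < t - 1 := sub_pos.2 ht.1
  have hη0 : 0 < ‖η‖ := norm_pos_iff.2 hη
  have hθ0 : 0 ≤ τ / γ := by positivity
  have hθ1 : τ / γ ≤ 1 := (div_le_one hγ0).2 hτ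
  have hB : 1 ≤ B ^ (τ / γ) := Real.one_le_rpow (ht.1.le.trans ht.2) hθ0
  have htγ : t - 1 ≤ t ^ γ - 1 := by
    simpa using Real.rpow_le_rpow_of_exponent_le ht.1.le hγ
  have hone : Real.exp (‖η‖ ^ γ * (1 - t ^ γ)) ≤ B ^ (τ / γ) * (t - 1) ^ (-(τ / γ)) := by
    refine (Real.exp_le_one_iff.2
      (mul_nonpos_of_nonneg_of_nonpos (by positivity) (by linarith))).trans ?_
    rw [Real.rpow_neg ht0.le, ← div_eq_mul_inv, one_le_div (by positivity)]
    exact Real.rpow_le_rpow ht0.le (by linarith [ht.2]) hθ0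
  have hdecay : Real.exp (‖η‖ ^ γ * (1 - t ^ γ)) ≤
      B ^ (τ / γ) * (t - 1) ^ (-(τ / γ)) * ‖η‖ ^ (-τ) := by
    calc Real.exp (‖η‖ ^ γ * (1 - t ^ γ)) = Real.exp (-(‖η‖ ^ γ * (t ^ γ - 1))) := by ring_nf
      _ ≤ Real.exp (-(‖η‖ ^ γ * (t - 1))) := by gcongr
      _ ≤ (‖η‖ ^ γ * (t - 1)) ^ (-(τ / γ)) := exp_neg_le_rpow_neg (by positivity) hθ0 hθ1
      _ = 1 * (t - 1) ^ (-(τ / γ)) * ‖η‖ ^ (-τ) := by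
        rw [Real.mul_rpow (by positivity) ht0.le, ← Real.rpow_mul hη0.le, mul_neg,
          mul_div_cancel₀ _ hγ0.ne', one_mul, mul_comm]
      _ ≤ _ := by gcongr
  rw [mul_min, mul_one, ← ofReal_norm, ENNReal.ofReal_rpow_of_pos hη0,
    ← ENNReal.ofReal_mul (by positivity)]
  exact le_min (ENNReal.ofReal_le_ofReal hone) (ENNReal.ofReal_le_ofReal hdecay)

lemma div_rpow_le_mul {t a : ℝ} (ht : t ∈ Set.Ioc 1 B) (ha : 0 ≤ a) (c : ℝ) :
    a / t ^ c ≤ B ^ |c| * a := by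
  have ht0 : 0 < t := by linarith [ht.1]
  rw [div_eq_mul_inv, ← Real.rpow_neg ht0.le, mul_comm]
  gcongr
  calc t ^ (-c) ≤ t ^ |c| := Real.rpow_le_rpow_of_exponent_le ht.1.le (neg_le_abs c)
    _ ≤ B ^ |c| := Real.rpow_le_rpow ht0.le ht.2 (abs_nonneg c)

lemma cutWeight_le_cutWeight_smul [NormedSpace ℝ E] {e σ t : ℝ} (he : 0 ≤ e) (hσ : 0 ≤ σ)
    (ht : t ∈ Set.Ioc 1 B) (η : E) :
    cutWeight e σ η ≤ ENNReal.ofReal B ^ (e + σ) * cutWeight e σ (t • η) := by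
  have hB : 1 ≤ B := ht.1.le.trans ht.2
  have hsmul : ‖t • η‖ₑ = ENNReal.ofReal t * ‖η‖ₑ := by
    rw [enorm_smul, Real.enorm_of_nonneg (by linarith [ht.1])]
  refine cutWeight_le_of_comparable he hσ (by simpa using hB) ENNReal.ofReal_ne_top ?_ ?_
  · rw [hsmul, ← mul_assoc]
    exact le_mul_of_one_le_left' (one_le_mul (by simpa using hB) (by simpa using ht.1.le))
  · rw [hsmul]
    gcongr
    exact ht.2

variable [MeasurableSpace E] {μ : Measure E}

/-- The weighted norm with the weight `e^|x| |x|^ν`, for functions with values in `[0, ∞]`. -/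
noncomputable def expNorm (μ : Measure E) (ν p : ℝ) (f : E → ℝ≥0∞) : ℝ≥0∞ :=
  powNorm μ ν p fun x => ENNReal.ofReal (Real.exp ‖x‖) * f x

lemma ofReal_exp_mul_lintegral_le (f g : E → ℝ≥0∞) {y z : E} (hyz : ‖y‖ ≤ ‖z‖) :
    ENNReal.ofReal (Real.exp ‖y‖) * ∫⁻ x, f (z - x) * g x ∂μ ≤
      ∫⁻ x, ENNReal.ofReal (Real.exp ‖z - x‖) * f (z - x) *
        (ENNReal.ofReal (Real.exp ‖x‖) * g x) ∂μ := by
  rw [← lintegral_const_mul' _ _ ENNReal.ofReal_ne_top]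
  refine lintegral_mono fun x => ?_
  have hexp : ENNReal.ofReal (Real.exp ‖y‖) ≤
      ENNReal.ofReal (Real.exp ‖z - x‖) * ENNReal.ofReal (Real.exp ‖x‖) := by
    rw [← ENNReal.ofReal_mul (Real.exp_nonneg _), ← Real.exp_add]
    gcongr
    exact hyz.trans (by simpa using norm_add_le (z - x) x)
  calc _ ≤ ENNReal.ofReal (Real.exp ‖z - x‖) * ENNReal.ofReal (Real.exp ‖x‖) *
        (f (z - x) * g x) := mul_le_mul_left hexp _
    _ = _ := by ring

variable [NormedSpace ℝ E]

/-- The nonlinear term with every field replaced by its size and `1/β` by `B`. -/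
noncomputable def majorant (μ : Measure E) (γ c B : ℝ) (f g : E → ℝ≥0∞) (η : E) : ℝ≥0∞ :=
  ∫⁻ t in Set.Ioc 1 B, ENNReal.ofReal (Real.exp (‖η‖ ^ γ * (1 - t ^ γ)) / t ^ c) *
    (‖η‖ₑ * ∫⁻ x, f (t • η - x) * g x ∂μ)

lemma measurable_majorant [BorelSpace E] [SecondCountableTopology E] [SFinite μ] (γ c B : ℝ)
    {f g : E → ℝ≥0∞} (hf : Measurable f) (hg : Measurable g) :
    Measurable (majorant μ γ c B f g) := by
  have hconv : Measurable fun q : E × ℝ => ∫⁻ x, f (q.2 • q.1 - x) * g x ∂μ :=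
    (measurable_lintegral_sub_mul hf hg).comp (f := fun q : E × ℝ => q.2 • q.1) (by fun_prop)
  exact Measurable.lintegral_prod_right (f := fun η t =>
    ENNReal.ofReal (Real.exp (‖η‖ ^ γ * (1 - t ^ γ)) / t ^ c) *
      (‖η‖ₑ * ∫⁻ x, f (t • η - x) * g x ∂μ)) (by fun_prop)

lemma weight_mul_majorant_integrand_le {t τ : ℝ} (hγ : 1 ≤ γ) (hν : 0 ≤ ν) (hτ0 : 0 ≤ τ)
    (hτ : τ ≤ γ) (c : ℝ) (f g : E → ℝ≥0∞) (ht : t ∈ Set.Ioc 1 B) {η : E} (hη : η ≠ 0) :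
    ‖η‖ₑ ^ ν * (ENNReal.ofReal (Real.exp ‖η‖) *
      (ENNReal.ofReal (Real.exp (‖η‖ ^ γ * (1 - t ^ γ)) / t ^ c) *
        (‖η‖ₑ * ∫⁻ x, f (t • η - x) * g x ∂μ))) ≤
    ENNReal.ofReal (B ^ |c| * B ^ (τ / γ)) * ENNReal.ofReal B ^ (ν + 1 + τ) *
      ENNReal.ofReal ((t - 1) ^ (-(τ / γ))) * (cutWeight (ν + 1) τ (t • η) *
        ∫⁻ x, ENNReal.ofReal (Real.exp ‖t • η - x‖) * f (t • η - x) *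
          (ENNReal.ofReal (Real.exp ‖x‖) * g x) ∂μ) := by
  have hB : 0 ≤ B := by linarith [ht.1, ht.2]
  have hnorm : ‖η‖ ≤ ‖t • η‖ := by
    rw [norm_smul, Real.norm_of_nonneg (by linarith [ht.1])]
    exact le_mul_of_one_le_left (norm_nonneg η) ht.1.le
  set L := ENNReal.ofReal (B ^ |c| * B ^ (τ / γ) * (t - 1) ^ (-(τ / γ))) with hL
  have hexp : ENNReal.ofReal (Real.exp (‖η‖ ^ γ * (1 - t ^ γ)) / t ^ c) ≤
      L * min 1 (‖η‖ₑ ^ (-τ)) := by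
    refine (ENNReal.ofReal_le_ofReal (div_rpow_le_mul ht (Real.exp_nonneg _) c)).trans ?_
    rw [hL, mul_assoc, ENNReal.ofReal_mul (by positivity), ENNReal.ofReal_mul (by positivity),
      mul_assoc]
    exact mul_le_mul_right (ofReal_exp_mul_one_sub_rpow_le hγ hτ0 hτ ht hη) _
  calc _ = ENNReal.ofReal (Real.exp (‖η‖ ^ γ * (1 - t ^ γ)) / t ^ c) * (‖η‖ₑ ^ ν * ‖η‖ₑ) *
        (ENNReal.ofReal (Real.exp ‖η‖) * ∫⁻ x, f (t • η - x) * g x ∂μ) := by ring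
    _ ≤ L * min 1 (‖η‖ₑ ^ (-τ)) * (‖η‖ₑ ^ ν * ‖η‖ₑ) * _ :=
      mul_le_mul' (mul_le_mul_left hexp _) (ofReal_exp_mul_lintegral_le f g hnorm)
    _ = L * cutWeight (ν + 1) τ η * _ := by
      rw [cutWeight, enorm_rpow_add hη, ENNReal.rpow_one, mul_assoc L, mul_comm (min _ _)]
    _ ≤ L * (ENNReal.ofReal B ^ (ν + 1 + τ) * cutWeight (ν + 1) τ (t • η)) * _ := by
      gcongr
      exact cutWeight_le_cutWeight_smul (by linarith) hτ0 ht η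
    _ = _ := by
      rw [hL, ENNReal.ofReal_mul (by positivity)]
      ring

lemma setLIntegral_Ioc_sub_one_rpow_lt_top {θ : ℝ} (hθ : θ < 1) (hB : 1 ≤ B) :
    ∫⁻ t in Set.Ioc 1 B, ENNReal.ofReal ((t - 1) ^ (-θ)) < ∞ := by
  have hint : IntervalIntegrable (fun t : ℝ => (t - 1) ^ (-θ)) volume 1 B := by
    simpa using (intervalIntegral.intervalIntegrable_rpow' (a := 0) (b := B - 1)
      (by linarith : -1 < -θ)).comp_sub_right 1
  exact (hasFiniteIntegral_iff_ofReal (by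
    filter_upwards [ae_restrict_mem measurableSet_Ioc] with t ht
    exact Real.rpow_nonneg (sub_nonneg.2 ht.1.le) _)).1
      ((intervalIntegrable_iff_integrableOn_Ioc_of_le hB).1 hint).2

variable [BorelSpace E] [FiniteDimensional ℝ E] [μ.IsAddHaarMeasure]

lemma eLpNorm'_comp_smul_le (f : E → ℝ≥0∞) {t : ℝ} (hp : 0 ≤ p) (ht : 1 ≤ t) :
    eLpNorm' (fun x => f (t • x)) p μ ≤ eLpNorm' f p μ := by
  rw [eLpNorm'_comp_smul_of_pos f hp (by linarith)]
  refine mul_le_of_le_one_left' ?_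
  rw [ENNReal.rpow_neg, ENNReal.inv_le_one]
  simpa only [ENNReal.one_rpow] using ENNReal.rpow_le_rpow (z := finrank ℝ E / p)
    (ENNReal.one_le_ofReal.2 ht) (by positivity)

/-- The factor `e^(|η|^γ (1 - t^γ)) ≲ (t - 1)^(-τ/γ) |η|^(-τ)` is integrable in `t` for `τ < γ`,
and supplies the decay that the weighted convolution inequality asks for. -/
theorem exists_expNorm_majorant_le [Nontrivial E] (hp : 2 < p)
    (hν : finrank ℝ E * (1 - 2 / p) < 2 * ν) (hν' : ν < finrank ℝ E * (1 - 1 / p))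
    (hγ : 1 + (finrank ℝ E * (1 - 1 / p) - ν) < γ) (hB : 1 ≤ B) (c : ℝ) :
    ∃ C : ℝ≥0∞, C ≠ ∞ ∧ ∀ f g : E → ℝ≥0∞, Measurable f → Measurable g →
      expNorm μ ν p (majorant μ γ c B f g) ≤ C * (expNorm μ ν p f * expNorm μ ν p g) := by
  obtain ⟨τ, hτ, hτγ⟩ := exists_between hγ
  have hp0 : 0 < p := by linarith
  have hν0 : 0 ≤ ν := (weight_exponent_pos hp hν).le
  obtain ⟨C, hC, hconv⟩ :=
    exists_eLpNorm'_cutWeight_mul_convolution_le (μ := μ) hp hν hν' zero_le_one hτ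
  set K := ENNReal.ofReal (B ^ |c| * B ^ (τ / γ)) * ENNReal.ofReal B ^ (ν + 1 + τ)
  set S := ∫⁻ t in Set.Ioc 1 B, ENNReal.ofReal ((t - 1) ^ (-(τ / γ)))
  have hS : S ≠ ∞ :=
    (setLIntegral_Ioc_sub_one_rpow_lt_top ((div_lt_one (by linarith)).2 hτγ) hB).ne
  refine ⟨K * S * C, by finiteness, fun f g hf hg => ?_⟩
  set H : E → ℝ≥0∞ := fun y => cutWeight (ν + 1) τ y *
    ∫⁻ x, ENNReal.ofReal (Real.exp ‖y - x‖) * f (y - x) *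
      (ENNReal.ofReal (Real.exp ‖x‖) * g x) ∂μ
  have hH : Measurable H := (measurable_cutWeight _ _).mul (measurable_lintegral_sub_mul
    (f := fun x => ENNReal.ofReal (Real.exp ‖x‖) * f x) (by fun_prop) (by fun_prop))
  let k : ℝ → E → ℝ≥0∞ := fun t η => K * ENNReal.ofReal ((t - 1) ^ (-(τ / γ))) * H (t • η)
  have hk : Measurable (Function.uncurry k) := by
    unfold k Function.uncurry
    fun_prop
  have hpointwise : ∀ᵐ η ∂μ, ‖η‖ₑ ^ ν * (ENNReal.ofReal (Real.exp ‖η‖) *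
      majorant μ γ c B f g η) ≤ ∫⁻ t in Set.Ioc 1 B, k t η := by
    filter_upwards [Measure.ae_ne μ 0] with η hη
    rw [majorant, ← lintegral_const_mul' _ _ ENNReal.ofReal_ne_top,
      ← lintegral_const_mul' _ _ (ENNReal.rpow_ne_top_of_nonneg hν0 enorm_ne_top)]
    exact setLIntegral_mono hk.of_uncurry_right fun t ht =>
      weight_mul_majorant_integrand_le (by linarith) hν0 (by linarith) hτγ.le c f g ht hη
  calc _ ≤ _ := eLpNorm'_mono_enorm_ae hp0.le hpointwise
    _ ≤ ∫⁻ t in Set.Ioc 1 B, eLpNorm' (k t) p μ := eLpNorm'_lintegral_le (by linarith) hk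
    _ ≤ ∫⁻ t in Set.Ioc 1 B, K * ENNReal.ofReal ((t - 1) ^ (-(τ / γ))) * eLpNorm' H p μ :=
      setLIntegral_mono (by fun_prop) fun t ht =>
        (eLpNorm'_const_mul_le hp0 (by fun_prop) _).trans
          (mul_le_mul_right (eLpNorm'_comp_smul_le H hp0.le ht.1.le) _)
    _ = K * S * eLpNorm' H p μ := by
      rw [lintegral_mul_const _ (by fun_prop), lintegral_const_mul _ (by fun_prop)]
    _ ≤ K * S * (C * (expNorm μ ν p f * expNorm μ ν p g)) :=
      mul_le_mul_right (hconv _ _ (by fun_prop) (by fun_prop)) _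
    _ = _ := by ring

end Majorant

section Increment

variable {E : Type*} [NormedAddCommGroup E] [MeasurableSpace E] {μ : Measure E} {ν p γ c β : ℝ}

lemma expNorm_mono_ae (hp : 0 ≤ p) {f g : E → ℝ≥0∞} (h : f ≤ᵐ[μ] g) :
    expNorm μ ν p f ≤ expNorm μ ν p g := by
  refine eLpNorm'_mono_enorm_ae hp ?_
  filter_upwards [h] with x hx
  simp only [enorm_eq_self]
  gcongr

lemma expNorm_congr_ae {f g : E → ℝ≥0∞} (h : f =ᵐ[μ] g) : expNorm μ ν p f = expNorm μ ν p g := by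
  refine eLpNorm'_congr_ae ?_
  filter_upwards [h] with x hx
  rw [hx]

lemma expNorm_const_mul_le [OpensMeasurableSpace E] (hp : 0 < p) {f : E → ℝ≥0∞}
    (hf : Measurable f) (a : ℝ≥0∞) :
    expNorm μ ν p (fun x => a * f x) ≤ a * expNorm μ ν p f := by
  simp only [expNorm, powNorm]
  convert eLpNorm'_const_mul_le (μ := μ)
    (f := fun x => ‖x‖ₑ ^ ν * (ENNReal.ofReal (Real.exp ‖x‖) * f x)) hp (by fun_prop) a using 3
  ring

lemma expNorm_add_le [OpensMeasurableSpace E] (hp : 1 ≤ p) {f g : E → ℝ≥0∞} (hf : Measurable f)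
    (hg : Measurable g) :
    expNorm μ ν p (fun x => f x + g x) ≤ expNorm μ ν p f + expNorm μ ν p g := by
  have weighted_measurable {u : E → ℝ≥0∞} (hu : Measurable u) :
      Measurable fun x => ‖x‖ₑ ^ ν * (ENNReal.ofReal (Real.exp ‖x‖) * u x) := by fun_prop
  simp only [expNorm, powNorm, mul_add]
  exact eLpNorm'_add_le (weighted_measurable hf).aestronglyMeasurable
    (weighted_measurable hg).aestronglyMeasurable hp

lemma ae_lt_top_of_expNorm_lt_top [OpensMeasurableSpace E] [NullSingletonClass μ] (hp : 0 < p)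
    {f : E → ℝ≥0∞} (hf : Measurable f) (h : expNorm μ ν p f < ∞) : ∀ᵐ x ∂μ, f x < ∞ := by
  have hint := lintegral_rpow_enorm_lt_top_of_eLpNorm'_lt_top hp h
  simp only [enorm_eq_self] at hint
  filter_upwards [ae_lt_top (by fun_prop) hint.ne, Measure.ae_ne μ 0] with x hx hx0
  have hfin := (ENNReal.rpow_lt_top_iff_of_pos hp).1 hx
  refine ENNReal.lt_top_of_mul_ne_top_right (a := ‖x‖ₑ ^ ν * ENNReal.ofReal (Real.exp ‖x‖))
    (by simpa only [mul_assoc] using hfin.ne) ?_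
  simp [enorm_rpow_ne_zero hx0, Real.exp_pos]

variable [NormedSpace ℝ E]

/-- The linear term with the field replaced by its size. -/
noncomputable def linTerm (γ c β : ℝ) (f : E → ℝ≥0∞) (η : E) : ℝ≥0∞ :=
  ENNReal.ofReal (β ^ c * Real.exp (‖η‖ ^ γ * (1 - 1 / β ^ γ))) * f (β⁻¹ • η)

/-- The bound for `|R_β[u] - R_β[v]|` obtained by polarizing the nonlinear term, where `f`, `g` and
`h` stand for `|u|`, `|v|` and `|u - v|`. -/
noncomputable def increment (μ : Measure E) (γ c β : ℝ) (f g h : E → ℝ≥0∞) (η : E) : ℝ≥0∞ :=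
  linTerm γ c β h η + ENNReal.ofReal (2 * γ) *
    (majorant μ γ c (1 / β) h f η + majorant μ γ c (1 / β) g h η)

section

variable [BorelSpace E]

lemma measurable_linTerm (γ c β : ℝ) {f : E → ℝ≥0∞} (hf : Measurable f) :
    Measurable (linTerm γ c β f) := by
  unfold linTerm
  fun_prop

lemma measurable_increment [SecondCountableTopology E] [SFinite μ] (γ c β : ℝ)
    {f g h : E → ℝ≥0∞} (hf : Measurable f) (hg : Measurable g) (hh : Measurable h) :
    Measurable (increment μ γ c β f g h) :=
  (measurable_linTerm γ c β hh).add
    (((measurable_majorant γ c _ hh hf).add (measurable_majorant γ c _ hg hh)).const_mul _)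

end

lemma majorant_comp_linearIsometryEquiv [BorelSpace E] (γ c B : ℝ) {f g : E → ℝ≥0∞}
    (L : E ≃ₗᵢ[ℝ] E) (hL : MeasurePreserving L μ μ) (hf : ∀ x, f (L x) = f x)
    (hg : ∀ x, g (L x) = g x) (η : E) :
    majorant μ γ c B f g (L η) = majorant μ γ c B f g η := by
  have hconv (t : ℝ) : ∫⁻ x, f (t • L η - x) * g x ∂μ = ∫⁻ x, f (t • η - x) * g x ∂μ := by
    rw [← hL.lintegral_comp_emb L.toHomeomorph.measurableEmbedding]
    simp only [hg, ← map_smul, ← map_sub, hf]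
  simp only [majorant, hconv, L.norm_map, L.enorm_map]

variable [BorelSpace E] [FiniteDimensional ℝ E] [μ.IsAddHaarMeasure]

lemma majorant_mono_ae (γ c B : ℝ) {f f' g g' : E → ℝ≥0∞} (hf : f ≤ᵐ[μ] f') (hg : g ≤ᵐ[μ] g')
    (η : E) : majorant μ γ c B f g η ≤ majorant μ γ c B f' g' η := by
  refine lintegral_mono fun t => ?_
  gcongr _ * (_ * ?_)
  refine lintegral_mono_ae ?_
  filter_upwards [(Measure.measurePreserving_sub_left μ (t • η)).quasiMeasurePreserving.ae hf, hg]
    with x hfx hgx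
  gcongr

lemma increment_mono_ae (hβ : 0 < β) {f f' g g' h h' : E → ℝ≥0∞} (hf : f ≤ᵐ[μ] f')
    (hg : g ≤ᵐ[μ] g') (hh : h ≤ᵐ[μ] h') :
    increment μ γ c β f g h ≤ᵐ[μ] increment μ γ c β f' g' h' := by
  filter_upwards [(Measure.quasiMeasurePreserving_smul μ (inv_ne_zero hβ.ne')).ae hh] with η hη
  exact add_le_add (mul_le_mul_right hη _) (mul_le_mul_right
    (add_le_add (majorant_mono_ae γ c _ hh hf η) (majorant_mono_ae γ c _ hg hh η)) _)

lemma expNorm_linTerm_le (hγ : 0 ≤ γ) (hβ0 : 0 < β) (hβ1 : β ≤ 1) (hp : 0 < p) {f : E → ℝ≥0∞}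
    (hf : Measurable f) :
    expNorm μ ν p (linTerm γ c β f) ≤
      ENNReal.ofReal (β ^ (c + ν + finrank ℝ E / p)) * expNorm μ ν p f := by
  set F : E → ℝ≥0∞ := fun x => ‖x‖ₑ ^ ν * (ENNReal.ofReal (Real.exp ‖x‖) * f x) with hF
  have hpointwise (ξ : E) : ‖β • ξ‖ₑ ^ ν * (ENNReal.ofReal (Real.exp ‖β • ξ‖) *
      linTerm γ c β f (β • ξ)) ≤ ENNReal.ofReal (β ^ (c + ν)) * F ξ := by
    have hnorm : ‖β • ξ‖ₑ ^ ν = ENNReal.ofReal (β ^ ν) * ‖ξ‖ₑ ^ ν := by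
      rw [enorm_smul, Real.enorm_of_nonneg hβ0.le,
        ENNReal.mul_rpow_of_ne_top ENNReal.ofReal_ne_top enorm_ne_top,
        ENNReal.ofReal_rpow_of_pos hβ0]
    have hexp : Real.exp ‖β • ξ‖ ≤ Real.exp ‖ξ‖ := by
      rw [norm_smul, Real.norm_of_nonneg hβ0.le]
      exact Real.exp_le_exp.2 (mul_le_of_le_one_left (norm_nonneg ξ) hβ1)
    have hdecay : Real.exp (‖β • ξ‖ ^ γ * (1 - 1 / β ^ γ)) ≤ 1 := by
      have : 1 ≤ 1 / β ^ γ :=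
        (one_le_div (by positivity)).2 (Real.rpow_le_one hβ0.le hβ1 hγ)
      exact Real.exp_le_one_iff.2 (mul_nonpos_of_nonneg_of_nonpos (by positivity) (by linarith))
    rw [linTerm, inv_smul_smul₀ hβ0.ne', hnorm]
    calc _ ≤ ENNReal.ofReal (β ^ ν) * ‖ξ‖ₑ ^ ν * (ENNReal.ofReal (Real.exp ‖ξ‖) *
          (ENNReal.ofReal (β ^ c * 1) * f ξ)) := by gcongr
      _ = _ := by
        rw [hF, mul_one, Real.rpow_add hβ0, ENNReal.ofReal_mul (by positivity)]
        ring
  calc _ ≤ eLpNorm' (fun η => ENNReal.ofReal (β ^ (c + ν)) * F (β⁻¹ • η)) p μ := by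
        refine eLpNorm'_mono_enorm_ae hp.le (.of_forall fun η => ?_)
        simpa only [enorm_eq_self, smul_inv_smul₀ hβ0.ne'] using hpointwise (β⁻¹ • η)
    _ ≤ ENNReal.ofReal (β ^ (c + ν)) * eLpNorm' (fun η => F (β⁻¹ • η)) p μ :=
      eLpNorm'_const_mul_le hp (by fun_prop) _
    _ = _ := by
      rw [eLpNorm'_comp_smul_of_pos F hp.le (inv_pos.2 hβ0), ← mul_assoc,
        ENNReal.ofReal_rpow_of_pos (by positivity), ← ENNReal.ofReal_mul (by positivity),
        Real.inv_rpow hβ0.le, Real.rpow_neg hβ0.le, inv_inv, ← Real.rpow_add hβ0]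
      rfl

lemma expNorm_increment_le (hp : 1 ≤ p) (hγ : 0 ≤ γ) (hβ0 : 0 < β) (hβ1 : β ≤ 1) {C a : ℝ≥0∞}
    (hmaj : ∀ f g : E → ℝ≥0∞, Measurable f → Measurable g →
      expNorm μ ν p (majorant μ γ c (1 / β) f g) ≤ C * (expNorm μ ν p f * expNorm μ ν p g))
    {f g h : E → ℝ≥0∞} (hf : Measurable f) (hg : Measurable g) (hh : Measurable h)
    (hfa : expNorm μ ν p f ≤ a) (hga : expNorm μ ν p g ≤ a) :
    expNorm μ ν p (increment μ γ c β f g h) ≤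
      (ENNReal.ofReal (β ^ (c + ν + finrank ℝ E / p)) + ENNReal.ofReal (4 * γ) * C * a) *
        expNorm μ ν p h := by
  have hp0 : 0 < p := by linarith
  have hhf := measurable_majorant (μ := μ) γ c (1 / β) hh hf
  have hgh := measurable_majorant (μ := μ) γ c (1 / β) hg hh
  set b := ENNReal.ofReal (β ^ (c + ν + finrank ℝ E / p))
  set N := expNorm μ ν p h
  calc _ ≤ expNorm μ ν p (linTerm γ c β h) + ENNReal.ofReal (2 * γ) *
        (expNorm μ ν p (majorant μ γ c (1 / β) h f) +
          expNorm μ ν p (majorant μ γ c (1 / β) g h)) :=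
        (expNorm_add_le hp (measurable_linTerm γ c β hh)
          ((hhf.add hgh).const_mul _)).trans (add_le_add_right
            ((expNorm_const_mul_le hp0 (hhf.add hgh) _).trans
              (mul_le_mul_right (expNorm_add_le hp hhf hgh) _)) _)
    _ ≤ b * N + ENNReal.ofReal (2 * γ) * (C * (N * a) + C * (a * N)) := by
      gcongr
      · exact expNorm_linTerm_le hγ hβ0 hβ1 hp0 hh
      · exact (hmaj h f hh hf).trans (by gcongr)
      · exact (hmaj g h hg hh).trans (by gcongr)
    _ = (b + 2 * ENNReal.ofReal (2 * γ) * C * a) * N := by ring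
    _ = _ := by
      rw [← ENNReal.ofReal_ofNat 2, ← ENNReal.ofReal_mul zero_le_two, ← mul_assoc]
      norm_num

/-- The nonlinear part of the increment is at most `k A` times the norm of `h`, so it is absorbed by
the gap between the linear part and `1` once `A` is small. -/
theorem exists_expNorm_increment_le [Nontrivial E] (hp : 2 < p)
    (hν : finrank ℝ E * (1 - 2 / p) < 2 * ν) (hν' : ν < finrank ℝ E * (1 - 1 / p))
    (hγ : 1 + (finrank ℝ E * (1 - 1 / p) - ν) < γ) (hc : 0 < c + ν + finrank ℝ E / p)
    (hβ0 : 0 < β) (hβ1 : β < 1) :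
    ∃ A : ℝ, 0 < A ∧ ∃ q : NNReal, q < 1 ∧ ∀ f g h : E → ℝ≥0∞, AEMeasurable f μ →
      AEMeasurable g μ → AEMeasurable h μ → expNorm μ ν p f ≤ ENNReal.ofReal A →
        expNorm μ ν p g ≤ ENNReal.ofReal A →
        expNorm μ ν p (increment μ γ c β f g h) ≤ q * expNorm μ ν p h := by
  obtain ⟨C, hC, hmaj⟩ :=
    exists_expNorm_majorant_le (μ := μ) hp hν hν' hγ ((one_le_div hβ0).2 hβ1.le) c
  have hγ0 : 0 ≤ γ := by linarith
  set b : ℝ := β ^ (c + ν + finrank ℝ E / p)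
  have hb0 : 0 ≤ b := by positivity
  have hb1 : b < 1 := Real.rpow_lt_one hβ0.le hβ1 hc
  lift C to NNReal using hC
  set k : ℝ := 4 * γ * C with hk
  have hk0 : 0 ≤ k := by positivity
  set A : ℝ := (1 - b) / (2 * (k + 1)) with hA
  have hA0 : 0 < A := div_pos (by linarith) (by positivity)
  have hkA : b + k * A ≤ (1 + b) / 2 := by
    have : 2 * (k + 1) * A = 1 - b := by rw [hA]; field_simp
    linarith
  refine ⟨A, hA0, ((1 + b) / 2).toNNReal, Real.toNNReal_lt_one.2 (by linarith),
    fun f g h hf hg hh hfA hgA => ?_⟩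
  rw [← expNorm_congr_ae hf.ae_eq_mk.symm] at hfA
  rw [← expNorm_congr_ae hg.ae_eq_mk.symm] at hgA
  calc _ ≤ expNorm μ ν p (increment μ γ c β (hf.mk f) (hg.mk g) (hh.mk h)) :=
        expNorm_mono_ae (by linarith)
          (increment_mono_ae hβ0 hf.ae_eq_mk.le hg.ae_eq_mk.le hh.ae_eq_mk.le)
    _ ≤ (ENNReal.ofReal b + ENNReal.ofReal (4 * γ) * C * ENNReal.ofReal A) *
        expNorm μ ν p (hh.mk h) :=
      expNorm_increment_le (by linarith) hγ0 hβ0 hβ1.le hmaj hf.measurable_mk hg.measurable_mk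
        hh.measurable_mk hfA hgA
    _ = ENNReal.ofReal (b + k * A) * expNorm μ ν p h := by
      rw [expNorm_congr_ae hh.ae_eq_mk.symm, ENNReal.ofReal_add hb0 (by positivity),
        ENNReal.ofReal_mul hk0, hk, ENNReal.ofReal_mul (p := 4 * γ) (by positivity),
        ENNReal.ofReal_coe_nnreal]
    _ ≤ _ := mul_le_mul_left (ENNReal.ofReal_le_ofReal hkA) _

end Increment

/-! ### Pointwise bounds for the renormalization operator -/

section Renorm

variable {d : ℕ} {γ β : ℝ}

lemma norm_dotRC_le (y : RSpace d) (v : CSpace d) : ‖dotRC y v‖ ≤ ‖y‖ * ‖v‖ := by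
  set w : CSpace d := WithLp.toLp 2 fun i => (y i : ℂ) with hw
  have hdot : dotRC y v = inner ℂ w v := by simp [hw, dotRC, PiLp.inner_apply, mul_comm]
  have hnorm : ‖w‖ = ‖y‖ := by simp [hw, EuclideanSpace.norm_eq]
  simpa only [hdot, hnorm] using norm_inner_le_norm (𝕜 := ℂ) w v

lemma norm_leray_le (y : RSpace d) (v : CSpace d) : ‖leray y v‖ ≤ 2 * ‖v‖ := by
  set w : CSpace d := WithLp.toLp 2 fun i => (y i : ℂ) with hw
  have hnorm : ‖w‖ = ‖y‖ := by simp [hw, EuclideanSpace.norm_eq]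
  have hleray : leray y v = v - (dotRC y v / ((‖y‖ ^ 2 : ℝ) : ℂ)) • w := by
    ext i; simp [hw, leray]
  have hproj : ‖dotRC y v‖ / ‖y‖ ^ 2 * ‖y‖ ≤ ‖v‖ := by
    rcases eq_or_ne y 0 with rfl | hy
    · simp
    · have hy0 : 0 < ‖y‖ := norm_pos_iff.2 hy
      rw [div_mul_eq_mul_div, div_le_iff₀ (by positivity)]
      nlinarith [norm_dotRC_le y v]
  calc ‖leray y v‖ ≤ ‖v‖ + ‖dotRC y v‖ / ‖y‖ ^ 2 * ‖y‖ := by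
        refine hleray ▸ (norm_sub_le _ _).trans_eq ?_
        rw [norm_smul, norm_div, Complex.norm_real, Real.norm_of_nonneg (by positivity), hnorm]
    _ ≤ 2 * ‖v‖ := by linarith

lemma dotRC_sub (y : RSpace d) (v w : CSpace d) : dotRC y (v - w) = dotRC y v - dotRC y w := by
  simp [dotRC, mul_sub, Finset.sum_sub_distrib]

lemma leray_sub (y : RSpace d) (v w : CSpace d) : leray y (v - w) = leray y v - leray y w := by
  ext i
  simp only [leray, dotRC_sub, PiLp.sub_apply]
  ring

/-- The polarization of `nonlinIntegrand`. -/
noncomputable def bilinIntegrand (γ : ℝ) (u v : RSpace d → CSpace d) (η : RSpace d) (t : ℝ)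
    (x : RSpace d) : CSpace d :=
  (Real.exp (‖η‖ ^ γ * (1 - t ^ γ)) / t ^ scalingExp d γ) •
    (dotRC η (u (t • η - x)) • leray η (v x))

lemma nonlinIntegrand_sub (γ : ℝ) (u v : RSpace d → CSpace d) (η : RSpace d) (t : ℝ)
    (x : RSpace d) :
    nonlinIntegrand γ u η t x - nonlinIntegrand γ v η t x =
      bilinIntegrand γ (u - v) u η t x + bilinIntegrand γ v (u - v) η t x := by
  simp only [nonlinIntegrand, bilinIntegrand, Pi.sub_apply, dotRC_sub, leray_sub, sub_smul,
    smul_sub]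
  abel

lemma measurable_bilinIntegrand (γ : ℝ) {u v : RSpace d → CSpace d} (hu : Measurable u)
    (hv : Measurable v) :
    Measurable fun q : (RSpace d × ℝ) × RSpace d => bilinIntegrand γ u v q.1.1 q.1.2 q.2 := by
  unfold bilinIntegrand leray dotRC
  fun_prop

lemma measurable_bilinIntegrand_right (γ : ℝ) {u v : RSpace d → CSpace d} (hu : Measurable u)
    (hv : Measurable v) (η : RSpace d) :
    Measurable fun z : ℝ × RSpace d => bilinIntegrand γ u v η z.1 z.2 :=
  (measurable_bilinIntegrand γ hu hv).comp
    (f := fun z : ℝ × RSpace d => ((η, z.1), z.2)) (by fun_prop)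

lemma enorm_bilinIntegrand_le (γ : ℝ) (u v : RSpace d → CSpace d) (η : RSpace d) {t : ℝ}
    (ht : 0 < t) (x : RSpace d) :
    ‖bilinIntegrand γ u v η t x‖ₑ ≤
      2 * (ENNReal.ofReal (Real.exp (‖η‖ ^ γ * (1 - t ^ γ)) / t ^ scalingExp d γ) *
        (‖η‖ₑ * (‖u (t • η - x)‖ₑ * ‖v x‖ₑ))) := by
  have hdot : ‖dotRC η (u (t • η - x))‖ₑ ≤ ‖η‖ₑ * ‖u (t • η - x)‖ₑ := by
    simpa only [ENNReal.ofReal_mul (norm_nonneg _), ofReal_norm] using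
      ENNReal.ofReal_le_ofReal (norm_dotRC_le η (u (t • η - x)))
  have hleray : ‖leray η (v x)‖ₑ ≤ 2 * ‖v x‖ₑ := by
    simpa only [ENNReal.ofReal_mul zero_le_two, ofReal_norm, ENNReal.ofReal_ofNat] using
      ENNReal.ofReal_le_ofReal (norm_leray_le η (v x))
  rw [bilinIntegrand, enorm_smul, enorm_smul, Real.enorm_eq_ofReal (by positivity)]
  calc _ ≤ ENNReal.ofReal (Real.exp (‖η‖ ^ γ * (1 - t ^ γ)) / t ^ scalingExp d γ) *
        ((‖η‖ₑ * ‖u (t • η - x)‖ₑ) * (2 * ‖v x‖ₑ)) := by gcongr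
    _ = _ := by ring

lemma lintegral_enorm_bilinIntegrand_le (γ β : ℝ) {u v : RSpace d → CSpace d} (hu : Measurable u)
    (hv : Measurable v) (η : RSpace d) :
    ∫⁻ z, ‖bilinIntegrand γ u v η z.1 z.2‖ₑ
        ∂((volume.restrict (Set.Ioc (1 : ℝ) (1 / β))).prod volume) ≤
      2 * majorant volume γ (scalingExp d γ) (1 / β) (‖u ·‖ₑ) (‖v ·‖ₑ) η := by
  rw [lintegral_prod _ (measurable_bilinIntegrand_right γ hu hv η).enorm.aemeasurable, majorant,
    ← lintegral_const_mul' _ _ (by simp)]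
  have hconv : Measurable fun t : ℝ => ∫⁻ x, ‖u (t • η - x)‖ₑ * ‖v x‖ₑ :=
    Measurable.lintegral_prod_right' (ν := volume)
      (f := fun z : ℝ × RSpace d => ‖u (z.1 • η - z.2)‖ₑ * ‖v z.2‖ₑ) (by fun_prop)
  refine setLIntegral_mono (by fun_prop) fun t ht => ?_
  rw [← lintegral_const_mul' _ _ enorm_ne_top, ← lintegral_const_mul' _ _ ENNReal.ofReal_ne_top,
    ← lintegral_const_mul' _ _ (by simp)]
  exact lintegral_mono fun x => enorm_bilinIntegrand_le γ u v η (by linarith [ht.1]) x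

lemma nonlinConverges_of_majorant_lt_top {u : RSpace d → CSpace d} (hu : Measurable u)
    {η : RSpace d}
    (h : majorant volume γ (scalingExp d γ) (1 / β) (‖u ·‖ₑ) (‖u ·‖ₑ) η < ∞) :
    NonlinConverges γ β u η :=
  ⟨(measurable_bilinIntegrand_right γ hu hu η).aestronglyMeasurable,
    (lintegral_enorm_bilinIntegrand_le γ β hu hu η).trans_lt (ENNReal.mul_lt_top (by simp) h)⟩

lemma nonlinIntegrand_congr_ae {ϑ θ : RSpace d → CSpace d} (h : ϑ =ᵐ[volume] θ) (γ : ℝ)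
    (η : RSpace d) (t : ℝ) : nonlinIntegrand γ ϑ η t =ᵐ[volume] nonlinIntegrand γ θ η t := by
  filter_upwards [h,
    (Measure.measurePreserving_sub_left volume (t • η)).quasiMeasurePreserving.ae h] with x hx hx'
  simp only [nonlinIntegrand, hx, hx']

lemma nonlinConverges_congr_ae {ϑ θ : RSpace d → CSpace d} (h : ϑ =ᵐ[volume] θ) {η : RSpace d}
    (hθ : NonlinConverges γ β θ η) : NonlinConverges γ β ϑ η := by
  refine Integrable.congr hθ ?_
  have hsub : Measure.QuasiMeasurePreserving (fun z : ℝ × RSpace d => z.1 • η - z.2)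
      ((volume.restrict (Set.Ioc (1 : ℝ) (1 / β))).prod volume) volume :=
    QuasiMeasurePreserving.prod_of_right (by fun_prop) (.of_forall fun t =>
      (Measure.measurePreserving_sub_left volume (t • η)).quasiMeasurePreserving)
  filter_upwards [hsub.ae h, Measure.quasiMeasurePreserving_snd.ae h] with z hz hz'
  simp only [nonlinIntegrand, hz, hz']

lemma renorm_congr_ae (γ : ℝ) (hβ : 0 < β) {ϑ θ : RSpace d → CSpace d} (h : ϑ =ᵐ[volume] θ) :
    renorm γ β ϑ =ᵐ[volume] renorm γ β θ := by
  filter_upwards [(Measure.quasiMeasurePreserving_smul volume (inv_ne_zero hβ.ne')).ae h] with η hη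
  simp only [renorm, hη]
  congr 3
  funext t
  exact integral_congr_ae (nonlinIntegrand_congr_ae h γ η t)

lemma renorm_zero (γ β : ℝ) : renorm γ β (0 : RSpace d → CSpace d) = 0 := by
  funext η
  simp [renorm, nonlinIntegrand, dotRC]

lemma stronglyMeasurable_renorm (γ : ℝ) (hβ0 : 0 < β) (hβ1 : β < 1) {u : RSpace d → CSpace d}
    (hu : Measurable u) : StronglyMeasurable (renorm γ β u) := by
  have hinner : StronglyMeasurable fun q : RSpace d × ℝ => ∫ x, nonlinIntegrand γ u q.1 q.2 x :=
    (measurable_bilinIntegrand γ hu hu).stronglyMeasurable.integral_prod_right' (ν := volume)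
  have houter : StronglyMeasurable fun η : RSpace d =>
      ∫ t in (1 : ℝ)..(1 / β), ∫ x, nonlinIntegrand γ u η t x := by
    simp only [intervalIntegral.integral_of_le ((one_le_div hβ0).2 hβ1.le)]
    exact hinner.integral_prod_right' (ν := volume.restrict (Set.Ioc (1 : ℝ) (1 / β)))
  have hlin : Measurable fun η : RSpace d =>
      (β ^ scalingExp d γ * Real.exp (‖η‖ ^ γ * (1 - 1 / β ^ γ))) • u (β⁻¹ • η) := by
    fun_prop
  exact hlin.stronglyMeasurable.add (houter.const_smul (Complex.I * (γ : ℂ)))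

lemma renorm_eq_integral_prod (hβ0 : 0 < β) (hβ1 : β < 1) {u : RSpace d → CSpace d}
    {η : RSpace d} (h : NonlinConverges γ β u η) :
    renorm γ β u η =
      (β ^ scalingExp d γ * Real.exp (‖η‖ ^ γ * (1 - 1 / β ^ γ))) • u (β⁻¹ • η) +
        (Complex.I * (γ : ℂ)) • ∫ z, nonlinIntegrand γ u η z.1 z.2
          ∂((volume.restrict (Set.Ioc (1 : ℝ) (1 / β))).prod volume) := by
  rw [renorm, intervalIntegral.integral_of_le ((one_le_div hβ0).2 hβ1.le), integral_prod _ h]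

lemma enorm_integral_nonlinIntegrand_sub_le (γ β : ℝ) {u v : RSpace d → CSpace d}
    (hu : Measurable u) (hv : Measurable v) (η : RSpace d) :
    ‖∫ z, (nonlinIntegrand γ u η z.1 z.2 - nonlinIntegrand γ v η z.1 z.2)
        ∂((volume.restrict (Set.Ioc (1 : ℝ) (1 / β))).prod volume)‖ₑ ≤
      2 * (majorant volume γ (scalingExp d γ) (1 / β) (fun x => ‖u x - v x‖ₑ) (‖u ·‖ₑ) η +
        majorant volume γ (scalingExp d γ) (1 / β) (‖v ·‖ₑ) (fun x => ‖u x - v x‖ₑ) η) := by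
  simp only [nonlinIntegrand_sub]
  calc _ ≤ ∫⁻ z, (‖bilinIntegrand γ (u - v) u η z.1 z.2‖ₑ +
          ‖bilinIntegrand γ v (u - v) η z.1 z.2‖ₑ)
          ∂((volume.restrict (Set.Ioc (1 : ℝ) (1 / β))).prod volume) :=
        (enorm_integral_le_lintegral_enorm _).trans (lintegral_mono fun z => enorm_add_le _ _)
    _ ≤ _ := by
      rw [lintegral_add_left (measurable_bilinIntegrand_right γ (hu.sub hv) hu η).enorm, mul_add]
      exact add_le_add (lintegral_enorm_bilinIntegrand_le γ β (hu.sub hv) hu η)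
        (lintegral_enorm_bilinIntegrand_le γ β hv (hu.sub hv) η)

lemma enorm_renorm_sub_le_increment (hγ : 0 ≤ γ) (hβ0 : 0 < β) (hβ1 : β < 1)
    {u v : RSpace d → CSpace d} (hu : Measurable u) (hv : Measurable v) {η : RSpace d}
    (hcu : NonlinConverges γ β u η) (hcv : NonlinConverges γ β v η) :
    ‖renorm γ β u η - renorm γ β v η‖ₑ ≤
      increment volume γ (scalingExp d γ) β (‖u ·‖ₑ) (‖v ·‖ₑ) (fun x => ‖u x - v x‖ₑ) η := by
  have hconst : ‖Complex.I * (γ : ℂ)‖ₑ = ENNReal.ofReal γ := by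
    rw [← ofReal_norm]
    simp [abs_of_nonneg hγ]
  rw [renorm_eq_integral_prod hβ0 hβ1 hcu, renorm_eq_integral_prod hβ0 hβ1 hcv, add_sub_add_comm,
    ← smul_sub, ← smul_sub, ← integral_sub hcu hcv, increment, linTerm]
  refine (enorm_add_le _ _).trans (add_le_add ?_ ?_)
  · rw [enorm_smul, Real.enorm_eq_ofReal (by positivity)]
  · rw [enorm_smul, hconst, mul_comm 2 γ, ENNReal.ofReal_mul hγ, ENNReal.ofReal_ofNat, mul_assoc]
    exact mul_le_mul_right (enorm_integral_nonlinIntegrand_sub_le γ β hu hv η) _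

end Renorm

/-! ### Balls of weighted fields -/

section Balls

variable {d : ℕ} {γ β ν p A : ℝ} {q : NNReal}

/-- The ball `{ϑ ∈ 𝔏^p_{u_ν} : ‖ϑ‖_{u_ν,p} ≤ A}`, without any radial symmetry. -/
def lpBall (d : ℕ) (ν p A : ℝ) : Set (RSpace d → CSpace d) :=
  {ϑ | MemL ν p ϑ ∧ wnorm ν p ϑ ≤ ENNReal.ofReal A}

/-- The estimate behind the contraction property, stated for sizes of fields: on the ball of radius
`A`, the bound `increment` for `|R_β[u] - R_β[v]|` shrinks the weighted norm of `|u - v|` by the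
factor `q`. -/
def IncrementBound (d : ℕ) (γ β ν p A : ℝ) (q : NNReal) : Prop :=
  ∀ f g h : RSpace d → ℝ≥0∞, AEMeasurable f → AEMeasurable g → AEMeasurable h →
    expNorm volume ν p f ≤ ENNReal.ofReal A → expNorm volume ν p g ≤ ENNReal.ofReal A →
      expNorm volume ν p (increment volume γ (scalingExp d γ) β f g h) ≤
        q * expNorm volume ν p h

lemma measurable_weight (ν : ℝ) : Measurable (weight (d := d) ν) := by
  unfold weight
  fun_prop

lemma wnorm_congr_ae {f g : RSpace d → CSpace d} (h : f =ᵐ[volume] g) :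
    wnorm ν p f = wnorm ν p g := by
  refine eLpNorm_congr_ae ?_
  filter_upwards [h] with x hx
  rw [hx]

lemma wnorm_zero : wnorm ν p (0 : RSpace d → CSpace d) = 0 := by
  simp [wnorm]

lemma radialBall_subset_radiallyBoundedBall :
    radialBall d ν p A ⊆ radiallyBoundedBall d ν p A :=
  fun ϑ hϑ => ⟨hϑ.1, ϑ, hϑ, .of_forall fun _ => le_rfl⟩

lemma radiallyBoundedBall_subset_lpBall : radiallyBoundedBall d ν p A ⊆ lpBall d ν p A := by
  rintro ϑ ⟨hϑ, g, hg, hle⟩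
  refine ⟨hϑ, (eLpNorm_mono_ae ?_).trans hg.2.2⟩
  filter_upwards [hle] with x hx
  simp only [norm_smul]
  gcongr

lemma zero_mem_lpBall : (0 : RSpace d → CSpace d) ∈ lpBall d ν p A :=
  ⟨⟨aestronglyMeasurable_zero, by simp [wnorm_zero]⟩, by simp [wnorm_zero]⟩

lemma convex_radialBall (d : ℕ) (ν : ℝ) (hp : 1 ≤ p) (A : ℝ) :
    Convex ℝ (radialBall d ν p A) := by
  rintro f ⟨⟨hf, -⟩, ⟨f', hf', hff'⟩, hfA⟩ g ⟨⟨hg, -⟩, ⟨g', hg', hgg'⟩, hgA⟩ a b ha hb hab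
  have weighted {u : RSpace d → CSpace d} (hu : AEStronglyMeasurable u) :
      AEStronglyMeasurable fun x => weight ν x • u x :=
    (measurable_weight ν).aestronglyMeasurable.smul hu
  have hsplit : (fun x => weight ν x • (a • f + b • g) x) =
      a • (fun x => weight ν x • f x) + b • fun x => weight ν x • g x := by
    funext x
    simp only [Pi.add_apply, Pi.smul_apply, smul_add, smul_comm (weight ν x)]
  have hle : wnorm ν p (a • f + b • g) ≤ ENNReal.ofReal A := by
    calc wnorm ν p (a • f + b • g) ≤ ENNReal.ofReal a * wnorm ν p f +
          ENNReal.ofReal b * wnorm ν p g := by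
          rw [wnorm, hsplit]
          refine (eLpNorm_add_le ((weighted hf).const_smul a) ((weighted hg).const_smul b)
            (by simpa using hp)).trans_eq ?_
          rw [eLpNorm_const_smul, eLpNorm_const_smul, Real.enorm_eq_ofReal ha,
            Real.enorm_eq_ofReal hb, wnorm, wnorm]
      _ ≤ ENNReal.ofReal a * ENNReal.ofReal A + ENNReal.ofReal b * ENNReal.ofReal A := by gcongr
      _ = ENNReal.ofReal A := by
        rw [← add_mul, ← ENNReal.ofReal_add ha hb, hab, ENNReal.ofReal_one, one_mul]
  refine ⟨⟨(hf.const_smul a).add (hg.const_smul b), hle.trans_lt ENNReal.ofReal_lt_top⟩,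
    ⟨a • f' + b • g', by fun_prop, ?_⟩, hle⟩
  filter_upwards [hff', hgg'] with x hfx hgx
  simp [hfx, hgx]

lemma increment_eq_of_norm_eq (γ c β : ℝ) {f g h : RSpace d → ℝ≥0∞}
    (hf : ∀ x y, ‖x‖ = ‖y‖ → f x = f y) (hg : ∀ x y, ‖x‖ = ‖y‖ → g x = g y)
    (hh : ∀ x y, ‖x‖ = ‖y‖ → h x = h y) {η ξ : RSpace d} (hηξ : ‖η‖ = ‖ξ‖) :
    increment volume γ c β f g h η = increment volume γ c β f g h ξ := by
  obtain ⟨L, rfl⟩ : ∃ L : RSpace d ≃ₗᵢ[ℝ] RSpace d, L η = ξ := ⟨_, Submodule.reflection_sub hηξ⟩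
  have hL {u : RSpace d → ℝ≥0∞} (hu : ∀ x y, ‖x‖ = ‖y‖ → u x = u y) (x : RSpace d) :
      u (L x) = u x := hu _ _ (L.norm_map x)
  simp only [increment, linTerm, L.norm_map, ← map_smul, hL hh,
    majorant_comp_linearIsometryEquiv _ _ _ L L.measurePreserving (hL hh) (hL hf),
    majorant_comp_linearIsometryEquiv _ _ _ L L.measurePreserving (hL hg) (hL hh)]

variable [NeZero d]

lemma wnorm_eq_expNorm (hp : 0 < p) (f : RSpace d → CSpace d) :
    wnorm ν p f = expNorm volume ν p (‖f ·‖ₑ) := by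
  rw [wnorm, eLpNorm_eq_eLpNorm' (by simpa using hp) ENNReal.ofReal_ne_top,
    ENNReal.toReal_ofReal hp.le, expNorm, powNorm, eLpNorm'_eq_lintegral_enorm,
    eLpNorm'_eq_lintegral_enorm]
  congr 1
  refine lintegral_congr_ae ?_
  filter_upwards [Measure.ae_ne volume 0] with x hx
  have hx0 : 0 < ‖x‖ := norm_pos_iff.2 hx
  simp only [enorm_smul, enorm_eq_self]
  rw [Real.enorm_eq_ofReal (by unfold weight; positivity), weight, mul_comm (Real.exp _),
    ENNReal.ofReal_mul (by positivity), ← ENNReal.ofReal_rpow_of_pos hx0, ofReal_norm, mul_assoc]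

lemma ae_eq_zero_of_wnorm_eq_zero (hp : 0 < p) {f : RSpace d → CSpace d}
    (hf : AEStronglyMeasurable f) (h : wnorm ν p f = 0) : f =ᵐ[volume] 0 := by
  have hzero := (eLpNorm_eq_zero_iff ((measurable_weight ν).aestronglyMeasurable.smul hf)
    (by simpa using hp)).1 h
  filter_upwards [hzero, Measure.ae_ne volume 0] with x hx hx0
  have hweight : weight ν x ≠ 0 := by
    have : 0 < ‖x‖ := norm_pos_iff.2 hx0
    unfold weight
    positivity
  exact (smul_eq_zero.1 hx).resolve_left hweight

lemma expNorm_enorm_le_of_mem_lpBall (hp : 0 < p) {ϑ : RSpace d → CSpace d}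
    (hϑ : ϑ ∈ lpBall d ν p A) : expNorm volume ν p (‖ϑ ·‖ₑ) ≤ ENNReal.ofReal A :=
  wnorm_eq_expNorm hp ϑ ▸ hϑ.2

lemma exists_radialBall_enorm_ge (hp : 0 < p) {D : RSpace d → ℝ≥0∞} (hD : Measurable D)
    (hrad : ∀ x y, ‖x‖ = ‖y‖ → D x = D y) (hDA : expNorm volume ν p D ≤ ENNReal.ofReal A) :
    ∃ g ∈ radialBall d ν p A, ∀ᵐ x, D x ≤ ‖g x‖ₑ := by
  set G : ℝ → CSpace d := fun s =>
    (D (s • EuclideanSpace.single 0 1)).toReal • EuclideanSpace.single 0 1 with hG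
  have hGmeas : Measurable G := by fun_prop
  have hGnorm (x : RSpace d) : ‖G ‖x‖‖ₑ = ENNReal.ofReal (D x).toReal := by
    have haxis : D (‖x‖ • EuclideanSpace.single 0 1) = D x := hrad _ _ (by simp [norm_smul])
    rw [hG, ← ofReal_norm]
    simp [haxis, norm_smul]
  have hGA : wnorm ν p (fun x : RSpace d => G ‖x‖) ≤ ENNReal.ofReal A := by
    rw [wnorm_eq_expNorm hp]
    exact (expNorm_mono_ae hp.le (.of_forall fun x =>
      (hGnorm x).trans_le ENNReal.ofReal_toReal_le)).trans hDA
  refine ⟨fun x => G ‖x‖, ⟨⟨(hGmeas.comp measurable_norm).aestronglyMeasurable,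
    hGA.trans_lt ENNReal.ofReal_lt_top⟩, ⟨G, hGmeas, .of_forall fun _ => rfl⟩, hGA⟩, ?_⟩
  filter_upwards [ae_lt_top_of_expNorm_lt_top hp hD (hDA.trans_lt ENNReal.ofReal_lt_top)] with x hx
  rw [hGnorm, ENNReal.ofReal_toReal hx.ne]

end Balls

section Contraction

variable {d : ℕ} [NeZero d] {γ β ν p A : ℝ} {q : NNReal}

lemma ae_nonlinConverges (hb : IncrementBound d γ β ν p A q) (hγ : 0 < γ) (hp : 0 < p)
    {ϑ : RSpace d → CSpace d} (hϑ : ϑ ∈ lpBall d ν p A) : ∀ᵐ η, NonlinConverges γ β ϑ η := by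
  obtain ⟨u, hu, hϑu⟩ := hϑ.1.1.aemeasurable
  have huA : expNorm volume ν p (‖u ·‖ₑ) ≤ ENNReal.ofReal A := by
    rw [← wnorm_eq_expNorm hp, ← wnorm_congr_ae hϑu]
    exact hϑ.2
  have hfin : expNorm volume ν p
      (increment volume γ (scalingExp d γ) β (‖u ·‖ₑ) (‖u ·‖ₑ) (‖u ·‖ₑ)) < ∞ :=
    (hb _ _ _ hu.enorm.aemeasurable hu.enorm.aemeasurable hu.enorm.aemeasurable huA huA).trans_lt
      (ENNReal.mul_lt_top ENNReal.coe_lt_top (huA.trans_lt ENNReal.ofReal_lt_top))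
  filter_upwards [ae_lt_top_of_expNorm_lt_top hp
    (measurable_increment γ _ β hu.enorm hu.enorm hu.enorm) hfin] with η hη
  refine nonlinConverges_congr_ae hϑu (nonlinConverges_of_majorant_lt_top hu ?_)
  have hsum := ENNReal.lt_top_of_mul_ne_top_right (ENNReal.add_lt_top.1 hη).2.ne (by simpa using hγ)
  exact (ENNReal.add_lt_top.1 hsum).1

lemma ae_enorm_renorm_sub_le (hb : IncrementBound d γ β ν p A q) (hγ : 0 < γ) (hp : 0 < p)
    (hβ0 : 0 < β) (hβ1 : β < 1) {ϑ₁ ϑ₂ : RSpace d → CSpace d} (hϑ₁ : ϑ₁ ∈ lpBall d ν p A)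
    (hϑ₂ : ϑ₂ ∈ lpBall d ν p A) :
    ∀ᵐ η, ‖renorm γ β ϑ₁ η - renorm γ β ϑ₂ η‖ₑ ≤
      increment volume γ (scalingExp d γ) β (‖ϑ₁ ·‖ₑ) (‖ϑ₂ ·‖ₑ) (fun x => ‖ϑ₁ x - ϑ₂ x‖ₑ) η := by
  obtain ⟨u, hu, h₁⟩ := hϑ₁.1.1.aemeasurable
  obtain ⟨v, hv, h₂⟩ := hϑ₂.1.1.aemeasurable
  have enorm_le {f g : RSpace d → CSpace d} (h : f =ᵐ[volume] g) :
      (‖g ·‖ₑ) ≤ᵐ[volume] (‖f ·‖ₑ) := by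
    filter_upwards [h] with x hx
    rw [hx]
  have hmono := increment_mono_ae (γ := γ) (c := scalingExp d γ) hβ0 (enorm_le h₁) (enorm_le h₂)
    (enorm_le (h₁.sub h₂))
  filter_upwards [ae_nonlinConverges hb hγ hp hϑ₁, ae_nonlinConverges hb hγ hp hϑ₂,
    renorm_congr_ae γ hβ0 h₁, renorm_congr_ae γ hβ0 h₂, hmono] with η hc₁ hc₂ hr₁ hr₂ hη
  rw [hr₁, hr₂]
  exact (enorm_renorm_sub_le_increment hγ.le hβ0 hβ1 hu hv
    (nonlinConverges_congr_ae h₁.symm hc₁) (nonlinConverges_congr_ae h₂.symm hc₂)).trans hη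

lemma wnorm_renorm_sub_le (hb : IncrementBound d γ β ν p A q) (hγ : 0 < γ) (hp : 0 < p)
    (hβ0 : 0 < β) (hβ1 : β < 1) {ϑ₁ ϑ₂ : RSpace d → CSpace d} (hϑ₁ : ϑ₁ ∈ lpBall d ν p A)
    (hϑ₂ : ϑ₂ ∈ lpBall d ν p A) :
    wnorm ν p (renorm γ β ϑ₁ - renorm γ β ϑ₂) ≤ q * wnorm ν p (ϑ₁ - ϑ₂) := by
  rw [wnorm_eq_expNorm hp, wnorm_eq_expNorm hp]
  exact (expNorm_mono_ae hp.le (ae_enorm_renorm_sub_le hb hγ hp hβ0 hβ1 hϑ₁ hϑ₂)).trans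
    (hb _ _ _ hϑ₁.1.1.enorm hϑ₂.1.1.enorm (hϑ₁.1.1.sub hϑ₂.1.1).enorm
      (expNorm_enorm_le_of_mem_lpBall hp hϑ₁) (expNorm_enorm_le_of_mem_lpBall hp hϑ₂))

lemma wnorm_renorm_le (hb : IncrementBound d γ β ν p A q) (hγ : 0 < γ) (hp : 0 < p)
    (hβ0 : 0 < β) (hβ1 : β < 1) {ϑ : RSpace d → CSpace d} (hϑ : ϑ ∈ lpBall d ν p A) :
    wnorm ν p (renorm γ β ϑ) ≤ q * wnorm ν p ϑ := by
  simpa only [renorm_zero, sub_zero] using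
    wnorm_renorm_sub_le hb hγ hp hβ0 hβ1 hϑ zero_mem_lpBall

lemma mapsTo_renorm_lpBall (hb : IncrementBound d γ β ν p A q) (hγ : 0 < γ) (hp : 0 < p)
    (hβ0 : 0 < β) (hβ1 : β < 1) (hq : q ≤ 1) :
    Set.MapsTo (renorm γ β) (lpBall d ν p A) (lpBall d ν p A) := by
  intro ϑ hϑ
  obtain ⟨u, hu, hϑu⟩ := hϑ.1.1.aemeasurable
  have hle : wnorm ν p (renorm γ β ϑ) ≤ ENNReal.ofReal A :=
    (wnorm_renorm_le hb hγ hp hβ0 hβ1 hϑ).trans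
      ((mul_le_of_le_one_left' (by exact_mod_cast hq)).trans hϑ.2)
  exact ⟨⟨(stronglyMeasurable_renorm γ hβ0 hβ1 hu).aestronglyMeasurable.congr
    (renorm_congr_ae γ hβ0 hϑu).symm, hle.trans_lt ENNReal.ofReal_lt_top⟩, hle⟩

lemma exists_radialBall_enorm_renorm_le (hb : IncrementBound d γ β ν p A q) (hγ : 0 < γ)
    (hp : 0 < p) (hβ0 : 0 < β) (hβ1 : β < 1) (hq : q ≤ 1) {ϑ : RSpace d → CSpace d}
    (hϑ : ϑ ∈ radiallyBoundedBall d ν p A) :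
    ∃ g ∈ radialBall d ν p A, ∀ᵐ η, ‖renorm γ β ϑ η‖ₑ ≤ ‖g η‖ₑ := by
  obtain ⟨-, g, ⟨-, ⟨G, hG, hgG⟩, hgA⟩, hle⟩ := id hϑ
  set w : RSpace d → ℝ≥0∞ := fun x => ‖G ‖x‖‖ₑ with hw_def
  have hw : Measurable w := by fun_prop
  have hwrad (x y : RSpace d) (hxy : ‖x‖ = ‖y‖) : w x = w y := by simp only [hw_def, hxy]
  have hϑw : (‖ϑ ·‖ₑ) ≤ᵐ[volume] w := by
    filter_upwards [hle, hgG] with x hx hxG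
    simpa only [hw_def, ← hxG] using enorm_le_iff_norm_le.2 hx
  have hwA : expNorm volume ν p w ≤ ENNReal.ofReal A := by
    rw [← wnorm_eq_expNorm hp (fun x => G ‖x‖), ← wnorm_congr_ae hgG]
    exact hgA
  have hzero : expNorm volume ν p (0 : RSpace d → ℝ≥0∞) ≤ ENNReal.ofReal A :=
    (expNorm_mono_ae hp.le (.of_forall fun _ => zero_le)).trans hwA
  obtain ⟨g', hg', hDg'⟩ := exists_radialBall_enorm_ge (A := A) hp
    (measurable_increment γ (scalingExp d γ) β hw (measurable_const (a := 0)) hw)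
    (fun _ _ => increment_eq_of_norm_eq γ _ β hwrad (fun _ _ _ => rfl) hwrad)
    ((hb w 0 w hw.aemeasurable aemeasurable_const hw.aemeasurable hwA hzero).trans
      ((mul_le_of_le_one_left' (by exact_mod_cast hq)).trans hwA))
  refine ⟨g', hg', ?_⟩
  filter_upwards [ae_enorm_renorm_sub_le hb hγ hp hβ0 hβ1 (radiallyBoundedBall_subset_lpBall hϑ)
    zero_mem_lpBall, hDg', increment_mono_ae (γ := γ) (c := scalingExp d γ) hβ0 hϑw
      (Filter.EventuallyLE.refl _ (0 : RSpace d → ℝ≥0∞)) hϑw] with η hη hDη hmono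
  simp only [renorm_zero, Pi.zero_apply, sub_zero, enorm_zero] at hη
  exact hη.trans (hmono.trans hDη)

lemma mapsTo_renorm_radiallyBoundedBall (hb : IncrementBound d γ β ν p A q) (hγ : 0 < γ)
    (hp : 0 < p) (hβ0 : 0 < β) (hβ1 : β < 1) (hq : q ≤ 1) :
    Set.MapsTo (renorm γ β) (radiallyBoundedBall d ν p A) (radiallyBoundedBall d ν p A) := by
  intro ϑ hϑ
  obtain ⟨g, hg, hle⟩ := exists_radialBall_enorm_renorm_le hb hγ hp hβ0 hβ1 hq hϑ
  refine ⟨(mapsTo_renorm_lpBall hb hγ hp hβ0 hβ1 hq (radiallyBoundedBall_subset_lpBall hϑ)).1,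
    g, hg, ?_⟩
  filter_upwards [hle] with η hη using enorm_le_iff_norm_le.1 hη

lemma renorm_ae_eq_self_iff (hb : IncrementBound d γ β ν p A q) (hγ : 0 < γ) (hp : 0 < p)
    (hβ0 : 0 < β) (hβ1 : β < 1) (hq : q < 1) {ϑ : RSpace d → CSpace d}
    (hϑ : ϑ ∈ lpBall d ν p A) : renorm γ β ϑ =ᵐ[volume] ϑ ↔ ϑ =ᵐ[volume] 0 := by
  constructor
  · intro hfix
    refine ae_eq_zero_of_wnorm_eq_zero (ν := ν) hp hϑ.1.1 ?_
    have hle := wnorm_renorm_le hb hγ hp hβ0 hβ1 hϑ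
    rw [wnorm_congr_ae hfix] at hle
    by_contra hne
    exact hle.not_gt (by simpa only [one_mul] using
      ENNReal.mul_lt_mul_left hne hϑ.1.2.ne (ENNReal.coe_lt_one_iff.2 hq))
  · intro hzero
    have hrenorm := renorm_congr_ae γ hβ0 hzero
    rw [renorm_zero] at hrenorm
    exact hrenorm.trans hzero.symm

end Contraction

/-! ### The parameter conditions -/

section Parameters

variable {d : ℕ} {γ p r ν κ : ℝ}

lemma mul_one_sub_two_div_lt_two_mul (hd : 0 < d) (hscal : 1 / r = 2 / p + (2 * ν + κ) / d - 1)
    (hκ : κ < d / r) : d * (1 - 2 / p) < 2 * ν := by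
  have hd0 : (0 : ℝ) < d := by exact_mod_cast hd
  have hκ_eq : κ = d / r - d * (2 / p - 1) - 2 * ν := by
    rw [div_eq_mul_one_div _ r, hscal]
    field_simp
    ring
  linarith

lemma scaling_eq_mul_one_add (hd : 0 < d) (hp : p ≠ 0) (hr : r ≠ 0)
    (hscal : 1 / r = 2 / p + (2 * ν + κ) / d - 1) :
    d * (r - p) / r + p * (ν + κ + 1) = p * (1 + (d * (1 - 1 / p) - ν)) := by
  have hd0 : (0 : ℝ) < d := by exact_mod_cast hd
  have hκ_eq : κ = d * (1 / r - 2 / p + 1) - 2 * ν := by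
    rw [hscal]
    field_simp
    ring
  rw [hκ_eq]
  field_simp
  ring

lemma two_lt_and_one_add_lt (hd : 0 < d) (hγ : 0 < γ) (hp : 0 < p) (hr : 0 < r)
    (hscal : 1 / r = 2 / p + (2 * ν + κ) / d - 1)
    (hlow : d + p * (scalingExp d γ + ν) < d * (r - p) / r + p * (ν + κ + 1))
    (hgap : γ < γ * p * (r - 1) / r - d * (r - p) / r - p * (ν + κ + 1)) :
    2 < p ∧ 1 + (d * (1 - 1 / p) - ν) < γ := by
  rw [sub_sub, scaling_eq_mul_one_add hd hp.ne' hr.ne' hscal] at hgap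
  rw [scaling_eq_mul_one_add hd hp.ne' hr.ne' hscal] at hlow
  set δ : ℝ := d * (1 - 1 / p) - ν with hδ
  have hδγ : γ < 2 * (1 + δ) := by
    have hlow_eq : d + p * (scalingExp d γ + ν) = p * (γ - 1 - δ) := by
      rw [scalingExp, hδ]
      field_simp
      ring
    linarith [lt_of_mul_lt_mul_left (hlow_eq ▸ hlow) hp.le]
  have hupper : p * (1 + δ) < γ * (p - 1) := by
    have hgap_eq : γ * p * (r - 1) / r = γ * p - γ * p / r := by field_simp
    have hpos : 0 < γ * p / r := by positivity
    linarith
  exact ⟨by nlinarith, lt_of_mul_lt_mul_left (by linarith : p * (1 + δ) < p * γ) hp.le⟩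

end Parameters

end NSRenorm

open NSRenorm Module in
theorem mainTheorem5_general (d : ℕ) (γ p ν β : ℝ) (hp : 2 < p)
    (hν_low : d * (1 - 2 / p) < 2 * ν) (hν_up : ν < d * (1 - 1 / p))
    (hγ : 1 + (d * (1 - 1 / p) - ν) < γ) (hβ0 : 0 < β) (hβ1 : β < 1) :
    ∃ A : ℝ, 0 < A ∧
      (∀ ϑ ∈ lpBall d ν p A, ∀ᵐ η, NonlinConverges γ β ϑ η) ∧
      Set.MapsTo (renorm γ β) (lpBall d ν p A) (lpBall d ν p A) ∧
      Set.MapsTo (renorm γ β) (radiallyBoundedBall d ν p A) (radiallyBoundedBall d ν p A) ∧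
      (∃ q : NNReal, q < 1 ∧ ∀ ϑ₁ ∈ lpBall d ν p A, ∀ ϑ₂ ∈ lpBall d ν p A,
        wnorm ν p (renorm γ β ϑ₁ - renorm γ β ϑ₂) ≤ q * wnorm ν p (ϑ₁ - ϑ₂)) ∧
      ∀ ϑ ∈ lpBall d ν p A, renorm γ β ϑ =ᵐ[volume] ϑ ↔ ϑ =ᵐ[volume] 0 := by
  have hp0 : 0 < p := by linarith
  have hγ0 : 0 < γ := by linarith
  have : NeZero d := ⟨by rintro rfl; simp at hν_low hν_up; linarith⟩
  have hlin : 0 < scalingExp d γ + ν + d / p := by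
    rw [scalingExp, div_eq_mul_one_div]
    linarith
  have hdim : (finrank ℝ (RSpace d) : ℝ) = d := by rw [finrank_euclideanSpace_fin]
  rw [← hdim] at hν_low hν_up hγ hlin
  obtain ⟨A, hA, q, hq, hb⟩ := exists_expNorm_increment_le (μ := (volume : Measure (RSpace d)))
    hp hν_low hν_up hγ hlin hβ0 hβ1
  exact ⟨A, hA, fun _ => ae_nonlinConverges hb hγ0 hp0,
    mapsTo_renorm_lpBall hb hγ0 hp0 hβ0 hβ1 hq.le,
    mapsTo_renorm_radiallyBoundedBall hb hγ0 hp0 hβ0 hβ1 hq.le,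
    ⟨q, hq, fun _ h₁ _ h₂ => wnorm_renorm_sub_le hb hγ0 hp0 hβ0 hβ1 h₁ h₂⟩,
    fun _ => renorm_ae_eq_self_iff hb hγ0 hp0 hβ0 hβ1 hq⟩

theorem mainTheorem5 (d : ℕ) (hd : 2 ≤ d) (γ p r ν κ : ℝ) (hγ : 0 < γ)
    (hp : 1 < p) (hr : 1 < r)
    (h1_scal : 1 / r = 2 / p + (2 * ν + κ) / d - 1)
    (h1_kappa : κ < d / r)
    (h1_nu_low : ((d : ℝ) - 1) / 2 * (1 - 2 / p) < ν)
    (h1_nu_up : ν < d * ((p - 1) / p))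
    (h1_rp : p ≤ 2 * r)
    (h1_max : 0 < max ν κ)
    (h1_sum : ((d : ℝ) - 1) * (1 / r - 1 / p) ≤ ν + κ)
    (h2_low : max 0 (d + p * (NSRenorm.scalingExp d γ + ν)) <
      d * (r - p) / r + p * (ν + κ + 1))
    (h2_up : d * (r - p) / r + p * (ν + κ + 1) < γ * p * (r - 1) / r)
    (h3 : γ < γ * p * (r - 1) / r - d * (r - p) / r - p * (ν + κ + 1))
    (h4 : r / (r - 1) < p)
    (β : ℝ) (hβ0 : 0 < β) (hβ1 : β < 1) :
    ∃ A : ℝ, 0 < A ∧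
      Convex ℝ (NSRenorm.radialBall d ν p A) ∧
      (∀ ϑ ∈ NSRenorm.radialBall d ν p A,
        (∀ᵐ η, NSRenorm.NonlinConverges γ β ϑ η) ∧
        NSRenorm.renorm γ β ϑ ∈ NSRenorm.radiallyBoundedBall d ν p A) ∧
      (∃ q : NNReal, q < 1 ∧
        ∀ ϑ₁ ∈ NSRenorm.radialBall d ν p A, ∀ ϑ₂ ∈ NSRenorm.radialBall d ν p A,
          NSRenorm.wnorm ν p (NSRenorm.renorm γ β ϑ₁ - NSRenorm.renorm γ β ϑ₂) ≤
            q * NSRenorm.wnorm ν p (ϑ₁ - ϑ₂)) ∧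
      (∀ ϑ ∈ NSRenorm.radialBall d ν p A,
        NSRenorm.renorm γ β ϑ =ᵐ[MeasureTheory.volume] ϑ ↔
          ϑ =ᵐ[MeasureTheory.volume] 0) := by
  have hd0 : 0 < d := by linarith
  have hp0 : 0 < p := by linarith
  obtain ⟨hp2, hγ_gap⟩ := NSRenorm.two_lt_and_one_add_lt hd0 hγ hp0 (by linarith) h1_scal
    ((le_max_right _ _).trans_lt h2_low) h3
  obtain ⟨A, hA, hconv, -, hmaps, ⟨q, hq, hcontr⟩, hfix⟩ := mainTheorem5_general d γ p ν β hp2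
    (NSRenorm.mul_one_sub_two_div_lt_two_mul hd0 h1_scal h1_kappa)
    (by rwa [sub_div, div_self hp0.ne'] at h1_nu_up) hγ_gap hβ0 hβ1
  have hradial := NSRenorm.radialBall_subset_radiallyBoundedBall (d := d) (ν := ν) (p := p) (A := A)
  have hlp := hradial.trans NSRenorm.radiallyBoundedBall_subset_lpBall
  exact ⟨A, hA, NSRenorm.convex_radialBall d ν hp.le A,
    fun ϑ hϑ => ⟨hconv ϑ (hlp hϑ), hmaps (hradial hϑ)⟩,
    ⟨q, hq, fun ϑ₁ h₁ ϑ₂ h₂ => hcontr ϑ₁ (hlp h₁) ϑ₂ (hlp h₂)⟩, fun ϑ hϑ => hfix ϑ (hlp hϑ)⟩
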